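/- Let $(\overline M,g_1)$ and $(M,g_2)$ be (smooth, Hausdorff, finite-dimensional, boundaryless) Riemannian manifolds with Levi-Civita connections $\nabla^{\overline M}$ and $\nabla$, and let $(\psi,\xi,\eta,g_2)$ be a Kenmotsu structure on $M$, i.e. an almost contact metric structure with $(\nabla_X\psi)Y=g_2(\psi X,Y)\xi-\eta(Y)\psi X$ and $\nabla_X\xi=X-\eta(X)\xi$. Let $F:\overline M\to M$ be a bi-slant Riemannian map with $\xi\in\Gamma(\mathrm{range}F_*)$. That is: $F$ is smooth; $g_2(F_*X,F_*Y)=g_1(X,Y)$ for all $X,Y\in(\ker F_*)^\perp$; and there is an orthogonal decomposition $\mathrm{range}F_*=\mathcal D_{\theta_1}\oplus\mathcal D_{\theta_2}\oplus\langle\xi\rangle$ into smooth distributions along $F$ with $\psi\mathcal D_{\theta_1}\perp\mathcal D_{\theta_2}$ and $\psi\mathcal D_{\theta_2}\perp\mathcal D_{\theta_1}$, such that for every nonzero $v\in\mathcal D_{\theta_i}$ the angle between $\psi v$ and $\mathcal D_{\theta_i}$ is the constant $\theta_i$ ($i=1,2$). Notation. For a vector field $W$ along $F$ let $\nabla^F_XW$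 be the pullback connection of $\nabla$. Put $(\nabla F_*)(X,Y)=\nabla^F_XF_*Y-F_*(\nabla^{\overline M}_XY)$. For $V$ normal to $\mathrm{range}F_*$ let $-S_VF_*X$ and $\nabla^{F\perp}_XV$ be the components of $\nabla^F_XV$ in $\mathrm{range}F_*$ and in $(\mathrm{range}F_*)^\perp$, and let $\psi V=\phi V+\omega V$ with $\phi V\in\mathrm{range}F_*$ and $\omega V\in(\mathrm{range}F_*)^\perp$. Let ${}^*F_*$ be the adjoint of $F_*$. To speak of $\mathrm{range}F_*$ and $(\mathrm{range}F_*)^\perp$ as distributions, let $D$ be a smooth distribution on an open set $U\supseteq F(\overline M)$ with $D_{F(p)}=\mathrm{range}F_{*p}$ for all $p\in\overline M$; sections of $\mathrm{range}F_*$ and $(\mathrm{range}F_*)^\perp$ are smooth sections of $D$ and $D^\perp$ over $U$. Say that $(\mathrm{range}F_*)^\perp$ defines a totally geodesic foliation (along $F(\overline M)$) if for all $V_1,V_2\in\Gamma((\mathrm{range}F_*)^\perp)$ the vectors $[V_1,V_2]$ and $\nabla_{V_1}V_2$ are normal to $\mathrm{range}F_*$ at every point of $F(\overline M)$. Then $(\mathrm{range}F_*)^\perp$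 defines a totally geodesic foliation if and only if $$g_2\big(S_{\omega V_1}F_*X-F_*(\nabla^{\overline M}_X\,{}^*F_*\phi V_1),\ \phi V_2\big)=g_2\big([V_1,F_*X],V_2\big)+g_2\big((\nabla F_*)(X,{}^*F_*\phi V_1)+\nabla_X^{F\perp}\omega V_1,\ \omega V_2\big)$$ at every point of $\overline M$, for all $X\in\Gamma((\ker F_*)^\perp)$ and $V_1,V_2\in\Gamma((\mathrm{range}F_*)^\perp)$. Here, at $p\in\overline M$, the bracket is formed with any section $Y$ of $\mathrm{range}F_*$ such that $Y_{F(p)}=F_{*p}X_p$ (the number $g_2([V_1,Y],V_2)_{F(p)}$ depends on $Y$ only through $Y_{F(p)}$). -/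

import Mathlib

open Bundle
open scoped Manifold ContDiff Bundle Topology

noncomputable section

namespace BiSlant

/-! All manifolds are without boundary and modelled on a finite-dimensional real normed space `E`
by the trivial model with corners `𝓘(ℝ, E)`. A Riemannian metric is an instance of
`RiemannianBundle` on the tangent bundle (which provides the inner product of each tangent space)
that is smooth, i.e. an `IsContMDiffRiemannianBundle` of class `∞`. -/

instance finiteDimensional_tangentSpace
    {E : Type*} [NormedAddCommGroup E] [NormedSpace ℝ E] [FiniteDimensional ℝ E]
    {M : Type*} [TopologicalSpace M] [ChartedSpace E M] (x : M) :
    FiniteDimensional ℝ (TangentSpace 𝓘(ℝ, E) x) :=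
  inferInstanceAs (FiniteDimensional ℝ E)

/-! ## Vector fields, distributions and foliations on one manifold -/

section OneManifold

variable {E : Type*} [NormedAddCommGroup E] [NormedSpace ℝ E] [FiniteDimensional ℝ E]
  {M : Type*} [TopologicalSpace M] [ChartedSpace E M] [IsManifold 𝓘(ℝ, E) ∞ M]

/-- The vector field `V` is smooth on the set `U`. -/
def SmoothFieldOn (U : Set M) (V : Π x : M, TangentSpace 𝓘(ℝ, E) x) : Prop :=
  ContMDiffOn 𝓘(ℝ, E) (𝓘(ℝ, E).prod 𝓘(ℝ, E)) ∞
    (fun x ↦ (⟨x, V x⟩ : TotalSpace E (fun x : M ↦ TangentSpace 𝓘(ℝ, E) x))) U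

/-- `D` is a smooth distribution on `U`: near every point of `U` it has a frame consisting of
finitely many smooth vector fields. -/
def IsSmoothDistributionOn (U : Set M) (D : Π x : M, Submodule ℝ (TangentSpace 𝓘(ℝ, E) x)) :
    Prop :=
  ∀ x ∈ U, ∃ W : Set M, IsOpen W ∧ x ∈ W ∧
    ∃ (k : ℕ) (s : Fin k → Π y : M, TangentSpace 𝓘(ℝ, E) y),
      (∀ i, SmoothFieldOn W (s i)) ∧
      ∀ y ∈ W, LinearIndependent ℝ (fun i ↦ s i y) ∧
        Submodule.span ℝ (Set.range fun i ↦ s i y) = D y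

/-- `V` is (on `U`) a smooth section of the distribution `D`: `V ∈ Γ(D|_U)`. -/
structure IsSectionOn (U : Set M) (D : Π x : M, Submodule ℝ (TangentSpace 𝓘(ℝ, E) x))
    (V : Π x : M, TangentSpace 𝓘(ℝ, E) x) : Prop where
  smooth : SmoothFieldOn U V
  mem : ∀ x ∈ U, V x ∈ D x

/-- The distribution `D` on `U` defines a totally geodesic foliation along `A ⊆ U`:
at the points of `A` it is involutive, and the second fundamental form of `D` with respect to the
connection `cov` vanishes, i.e. `∇_V W` is again tangent to `D` for all `V, W ∈ Γ(D)`.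
(`cov W x (V x)` is the value of `∇_V W` at `x`.) -/
def IsTotallyGeodesicFoliationAlong
    (cov : CovariantDerivative 𝓘(ℝ, E) E (fun x : M ↦ TangentSpace 𝓘(ℝ, E) x))
    (U : Set M) (D : Π x : M, Submodule ℝ (TangentSpace 𝓘(ℝ, E) x)) (A : Set M) : Prop :=
  ∀ V W : Π x : M, TangentSpace 𝓘(ℝ, E) x, IsSectionOn U D V → IsSectionOn U D W →
    ∀ x ∈ A, VectorField.mlieBracket 𝓘(ℝ, E) V W x ∈ D x ∧ cov W x (V x) ∈ D x

variable [RiemannianBundle (fun x : M ↦ TangentSpace 𝓘(ℝ, E) x)]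

/-- The orthogonal complement of a distribution. -/
def orthDistribution (D : Π x : M, Submodule ℝ (TangentSpace 𝓘(ℝ, E) x)) (x : M) :
    Submodule ℝ (TangentSpace 𝓘(ℝ, E) x) :=
  (D x)ᗮ

/-! ## Levi-Civita connection, Kenmotsu manifolds -/

/-- `cov` is the Levi-Civita connection: metric and torsion-free. -/
structure IsLeviCivita
    (cov : CovariantDerivative 𝓘(ℝ, E) E (fun x : M ↦ TangentSpace 𝓘(ℝ, E) x)) : Prop where
  metric : ∀ (X Y : Π x : M, TangentSpace 𝓘(ℝ, E) x) (x : M),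
    MDifferentiableAt 𝓘(ℝ, E) (𝓘(ℝ, E).prod 𝓘(ℝ, E))
      (fun x ↦ (⟨x, X x⟩ : TotalSpace E (fun x : M ↦ TangentSpace 𝓘(ℝ, E) x))) x →
    MDifferentiableAt 𝓘(ℝ, E) (𝓘(ℝ, E).prod 𝓘(ℝ, E))
      (fun x ↦ (⟨x, Y x⟩ : TotalSpace E (fun x : M ↦ TangentSpace 𝓘(ℝ, E) x))) x →
    ∀ u : TangentSpace 𝓘(ℝ, E) x,
      (mfderiv 𝓘(ℝ, E) 𝓘(ℝ, ℝ) (fun y ↦ (inner ℝ (X y) (Y y) : ℝ)) x u : ℝ)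
        = inner ℝ (cov X x u) (Y x) + inner ℝ (X x) (cov Y x u)
  torsionFree : ∀ (X Y : Π x : M, TangentSpace 𝓘(ℝ, E) x) (x : M),
    MDifferentiableAt 𝓘(ℝ, E) (𝓘(ℝ, E).prod 𝓘(ℝ, E))
      (fun x ↦ (⟨x, X x⟩ : TotalSpace E (fun x : M ↦ TangentSpace 𝓘(ℝ, E) x))) x →
    MDifferentiableAt 𝓘(ℝ, E) (𝓘(ℝ, E).prod 𝓘(ℝ, E))
      (fun x ↦ (⟨x, Y x⟩ : TotalSpace E (fun x : M ↦ TangentSpace 𝓘(ℝ, E) x))) x →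
    cov Y x (X x) - cov X x (Y x) = VectorField.mlieBracket 𝓘(ℝ, E) X Y x

/-- An almost contact metric structure `(ψ, ξ, η, g)` on `M`, where `g` is the Riemannian metric
of `M`. -/
structure IsAlmostContactMetric
    (ψ : Π x : M, TangentSpace 𝓘(ℝ, E) x →L[ℝ] TangentSpace 𝓘(ℝ, E) x)
    (ξ : Π x : M, TangentSpace 𝓘(ℝ, E) x)
    (η : Π x : M, TangentSpace 𝓘(ℝ, E) x →L[ℝ] ℝ) : Prop where
  smooth_psi : ContMDiff 𝓘(ℝ, E) (𝓘(ℝ, E).prod 𝓘(ℝ, E →L[ℝ] E)) ∞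
    (fun x ↦ (⟨x, ψ x⟩ : TotalSpace (E →L[ℝ] E)
      (fun x : M ↦ TangentSpace 𝓘(ℝ, E) x →L[ℝ] TangentSpace 𝓘(ℝ, E) x)))
  smooth_xi : SmoothFieldOn Set.univ ξ
  smooth_eta : ContMDiff 𝓘(ℝ, E) (𝓘(ℝ, E).prod 𝓘(ℝ, E →L[ℝ] ℝ)) ∞
    (fun x ↦ (⟨x, η x⟩ : TotalSpace (E →L[ℝ] ℝ)
      (fun x : M ↦ TangentSpace 𝓘(ℝ, E) x →L[ℝ] Bundle.Trivial M ℝ x)))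
  psi_psi : ∀ (x : M) (v : TangentSpace 𝓘(ℝ, E) x), ψ x (ψ x v) = -v + η x v • ξ x
  psi_xi : ∀ x : M, ψ x (ξ x) = 0
  eta_psi : ∀ (x : M) (v : TangentSpace 𝓘(ℝ, E) x), η x (ψ x v) = 0
  eta_xi : ∀ x : M, η x (ξ x) = 1
  inner_psi_psi : ∀ (x : M) (v w : TangentSpace 𝓘(ℝ, E) x),
    inner ℝ (ψ x v) (ψ x w) = inner ℝ v w - η x v * η x w
  inner_psi : ∀ (x : M) (v w : TangentSpace 𝓘(ℝ, E) x),
    inner ℝ (ψ x v) w = -inner ℝ v (ψ x w)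
  eta_eq : ∀ (x : M) (v : TangentSpace 𝓘(ℝ, E) x), η x v = inner ℝ v (ξ x)

/-- A Kenmotsu structure: an almost contact metric structure with
`(∇_X ψ) Y = g(ψ X, Y) ξ - η(Y) ψ X` and `∇_X ξ = X - η(X) ξ`, where
`(∇_X ψ) Y = ∇_X (ψ Y) - ψ (∇_X Y)`. -/
structure IsKenmotsu
    (cov : CovariantDerivative 𝓘(ℝ, E) E (fun x : M ↦ TangentSpace 𝓘(ℝ, E) x))
    (ψ : Π x : M, TangentSpace 𝓘(ℝ, E) x →L[ℝ] TangentSpace 𝓘(ℝ, E) x)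
    (ξ : Π x : M, TangentSpace 𝓘(ℝ, E) x)
    (η : Π x : M, TangentSpace 𝓘(ℝ, E) x →L[ℝ] ℝ) : Prop
    extends IsAlmostContactMetric ψ ξ η where
  cov_psi : ∀ (Y : Π x : M, TangentSpace 𝓘(ℝ, E) x) (x : M),
    MDifferentiableAt 𝓘(ℝ, E) (𝓘(ℝ, E).prod 𝓘(ℝ, E))
      (fun x ↦ (⟨x, Y x⟩ : TotalSpace E (fun x : M ↦ TangentSpace 𝓘(ℝ, E) x))) x →
    ∀ u : TangentSpace 𝓘(ℝ, E) x,
      cov (fun y ↦ ψ y (Y y)) x u - ψ x (cov Y x u)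
        = (inner ℝ (ψ x u) (Y x) : ℝ) • ξ x - η x (Y x) • ψ x u
  cov_xi : ∀ (x : M) (u : TangentSpace 𝓘(ℝ, E) x), cov ξ x u = u - η x u • ξ x

end OneManifold

/-! ## Maps between manifolds -/

section Maps

variable {E₁ : Type*} [NormedAddCommGroup E₁] [NormedSpace ℝ E₁] [FiniteDimensional ℝ E₁]
  {M₁ : Type*} [TopologicalSpace M₁] [ChartedSpace E₁ M₁] [IsManifold 𝓘(ℝ, E₁) ∞ M₁]
  {E₂ : Type*} [NormedAddCommGroup E₂] [NormedSpace ℝ E₂] [FiniteDimensional ℝ E₂]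
  {M₂ : Type*} [TopologicalSpace M₂] [ChartedSpace E₂ M₂] [IsManifold 𝓘(ℝ, E₂) ∞ M₂]

/-- The differential `F_{*p} : T_p M₁ → T_{F(p)} M₂`. -/
abbrev dMap (F : M₁ → M₂) (p : M₁) :
    TangentSpace 𝓘(ℝ, E₁) p →L[ℝ] TangentSpace 𝓘(ℝ, E₂) (F p) :=
  mfderiv 𝓘(ℝ, E₁) 𝓘(ℝ, E₂) F p

/-- `range F_{*p} ⊆ T_{F(p)} M₂`. -/
def rangeSpace (F : M₁ → M₂) (p : M₁) : Submodule ℝ (TangentSpace 𝓘(ℝ, E₂) (F p)) :=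
  LinearMap.range (dMap (E₁ := E₁) (E₂ := E₂) F p).toLinearMap

/-- Smoothness on `A` of a vector field `W` along `F` (a section of `F^* T M₂`). -/
def SmoothAlongOn (F : M₁ → M₂) (A : Set M₁) (W : Π p : M₁, TangentSpace 𝓘(ℝ, E₂) (F p)) :
    Prop :=
  ContMDiffOn 𝓘(ℝ, E₁) (𝓘(ℝ, E₂).prod 𝓘(ℝ, E₂)) ∞
    (fun p ↦ (⟨F p, W p⟩ : TotalSpace E₂ (fun x : M₂ ↦ TangentSpace 𝓘(ℝ, E₂) x))) A

/-- `D` is a smooth distribution along `F` (a smooth subbundle of `F^* T M₂`): locally it has a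
frame of smooth vector fields along `F`. -/
def IsSmoothDistributionAlong (F : M₁ → M₂)
    (D : Π p : M₁, Submodule ℝ (TangentSpace 𝓘(ℝ, E₂) (F p))) : Prop :=
  ∀ p : M₁, ∃ A : Set M₁, IsOpen A ∧ p ∈ A ∧
    ∃ (k : ℕ) (s : Fin k → Π q : M₁, TangentSpace 𝓘(ℝ, E₂) (F q)),
      (∀ i, SmoothAlongOn (E₁ := E₁) F A (s i)) ∧
      ∀ q ∈ A, LinearIndependent ℝ (fun i ↦ s i q) ∧
        Submodule.span ℝ (Set.range fun i ↦ s i q) = D q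

/-- The pullback connection `∇^F` of `cov` along `F`: the derivative at `p`, in direction
`u ∈ T_p M₁`, of a vector field `W` along `F`. In the trivialization `e` of `T M₂` around `F p`,
write `W = w^i (e_i ∘ F)` with the coordinate frame `e_i`; then
`∇^F_u W = dw^i(u) e_i + w^i(p) ∇_{F_* u} e_i`. In particular `∇^F_u (V ∘ F) = ∇_{F_* u} V` for
vector fields `V` on `M₂`. -/
def pullbackCov (cov : CovariantDerivative 𝓘(ℝ, E₂) E₂ (fun x : M₂ ↦ TangentSpace 𝓘(ℝ, E₂) x))
    (F : M₁ → M₂) (W : Π p : M₁, TangentSpace 𝓘(ℝ, E₂) (F p)) (p : M₁)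
    (u : TangentSpace 𝓘(ℝ, E₁) p) : TangentSpace 𝓘(ℝ, E₂) (F p) :=
  let e := trivializationAt E₂ (fun x : M₂ ↦ TangentSpace 𝓘(ℝ, E₂) x) (F p)
  let w : M₁ → E₂ := fun q ↦ (e ⟨F q, W q⟩).2
  let dw : E₂ := mfderiv 𝓘(ℝ, E₁) 𝓘(ℝ, E₂) w p u
  e.symm (F p) dw
    + cov (fun y ↦ e.symm y (w p)) (F p) (dMap (E₁ := E₁) (E₂ := E₂) F p u)

/-- The second fundamental form of `F`:
`(∇F_*)(X, Y) = ∇^F_X (F_* Y) - F_* (∇_X Y)`. -/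
def secondFundamentalForm
    (cov₁ : CovariantDerivative 𝓘(ℝ, E₁) E₁ (fun x : M₁ ↦ TangentSpace 𝓘(ℝ, E₁) x))
    (cov₂ : CovariantDerivative 𝓘(ℝ, E₂) E₂ (fun x : M₂ ↦ TangentSpace 𝓘(ℝ, E₂) x))
    (F : M₁ → M₂) (X Y : Π p : M₁, TangentSpace 𝓘(ℝ, E₁) p) (p : M₁) :
    TangentSpace 𝓘(ℝ, E₂) (F p) :=
  pullbackCov cov₂ F (fun q ↦ dMap (E₁ := E₁) (E₂ := E₂) F q (Y q)) p (X p)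
    - dMap (E₁ := E₁) (E₂ := E₂) F p (cov₁ Y p (X p))

variable [RiemannianBundle (fun x : M₂ ↦ TangentSpace 𝓘(ℝ, E₂) x)]

/-- Orthogonal projection of `T_{F(p)} M₂` onto `range F_{*p}`. -/
def rangePart (F : M₁ → M₂) (p : M₁) (v : TangentSpace 𝓘(ℝ, E₂) (F p)) :
    TangentSpace 𝓘(ℝ, E₂) (F p) :=
  (rangeSpace (E₁ := E₁) (E₂ := E₂) F p).starProjection v

/-- Orthogonal projection of `T_{F(p)} M₂` onto `(range F_{*p})^⊥`. -/
def normalPart (F : M₁ → M₂) (p : M₁) (v : TangentSpace 𝓘(ℝ, E₂) (F p)) :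
    TangentSpace 𝓘(ℝ, E₂) (F p) :=
  (rangeSpace (E₁ := E₁) (E₂ := E₂) F p)ᗮ.starProjection v

/-- `S_V F_* X`: minus the `range F_*`-component of `∇^F_X V`, for `V` a section of
`(range F_*)^⊥` along `F`. -/
def shapeOperator
    (cov₂ : CovariantDerivative 𝓘(ℝ, E₂) E₂ (fun x : M₂ ↦ TangentSpace 𝓘(ℝ, E₂) x))
    (F : M₁ → M₂) (V : Π p : M₁, TangentSpace 𝓘(ℝ, E₂) (F p))
    (X : Π p : M₁, TangentSpace 𝓘(ℝ, E₁) p) (p : M₁) : TangentSpace 𝓘(ℝ, E₂) (F p) :=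
  -rangePart (E₁ := E₁) F p (pullbackCov cov₂ F V p (X p))

/-- `∇^{F⊥}_X V`: the `(range F_*)^⊥`-component of `∇^F_X V`. -/
def normalConnection
    (cov₂ : CovariantDerivative 𝓘(ℝ, E₂) E₂ (fun x : M₂ ↦ TangentSpace 𝓘(ℝ, E₂) x))
    (F : M₁ → M₂) (X : Π p : M₁, TangentSpace 𝓘(ℝ, E₁) p)
    (V : Π p : M₁, TangentSpace 𝓘(ℝ, E₂) (F p)) (p : M₁) : TangentSpace 𝓘(ℝ, E₂) (F p) :=
  normalPart (E₁ := E₁) F p (pullbackCov cov₂ F V p (X p))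

/-- `φ V`, the `range F_*`-component of `ψ V`, as a vector field along `F`. -/
def phi (F : M₁ → M₂)
    (ψ : Π x : M₂, TangentSpace 𝓘(ℝ, E₂) x →L[ℝ] TangentSpace 𝓘(ℝ, E₂) x)
    (V : Π x : M₂, TangentSpace 𝓘(ℝ, E₂) x) (p : M₁) : TangentSpace 𝓘(ℝ, E₂) (F p) :=
  rangePart (E₁ := E₁) F p (ψ (F p) (V (F p)))

/-- `ω V`, the `(range F_*)^⊥`-component of `ψ V`, as a vector field along `F`. -/
def omega (F : M₁ → M₂)
    (ψ : Π x : M₂, TangentSpace 𝓘(ℝ, E₂) x →L[ℝ] TangentSpace 𝓘(ℝ, E₂) x)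
    (V : Π x : M₂, TangentSpace 𝓘(ℝ, E₂) x) (p : M₁) : TangentSpace 𝓘(ℝ, E₂) (F p) :=
  normalPart (E₁ := E₁) F p (ψ (F p) (V (F p)))

/-- `D` is a slant distribution along `F` with slant angle `θ`: for all nonzero `v ∈ D_p`, the
angle between `ψ v` and the subspace `D_p` (that is, between `ψ v` and its orthogonal projection
to `D_p`) is `θ`. -/
structure IsSlantDistribution (F : M₁ → M₂)
    (ψ : Π x : M₂, TangentSpace 𝓘(ℝ, E₂) x →L[ℝ] TangentSpace 𝓘(ℝ, E₂) x)
    (D : Π p : M₁, Submodule ℝ (TangentSpace 𝓘(ℝ, E₂) (F p))) (θ : ℝ) : Prop where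
  smooth : IsSmoothDistributionAlong (E₁ := E₁) F D
  angle_eq : ∀ (p : M₁), ∀ v ∈ D p, v ≠ 0 →
    InnerProductGeometry.angle (ψ (F p) v) ((D p).starProjection (ψ (F p) v)) = θ

variable [RiemannianBundle (fun x : M₁ ↦ TangentSpace 𝓘(ℝ, E₁) x)]

/-- The horizontal space `(ker F_{*p})^⊥`. -/
def horizontalSpace (F : M₁ → M₂) (p : M₁) : Submodule ℝ (TangentSpace 𝓘(ℝ, E₁) p) :=
  (LinearMap.ker (dMap (E₁ := E₁) (E₂ := E₂) F p).toLinearMap)ᗮ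

/-- The adjoint `^*F_{*p} : T_{F(p)} M₂ → T_p M₁` of `F_{*p}`. -/
def adjointMap (F : M₁ → M₂) (p : M₁) :
    TangentSpace 𝓘(ℝ, E₂) (F p) →ₗ[ℝ] TangentSpace 𝓘(ℝ, E₁) p :=
  LinearMap.adjoint (dMap (E₁ := E₁) (E₂ := E₂) F p).toLinearMap

/-- `F` is a Riemannian map: smooth, and `F_{*p}` preserves inner products of horizontal
vectors. -/
structure IsRiemannianMap (F : M₁ → M₂) : Prop where
  smooth : ContMDiff 𝓘(ℝ, E₁) 𝓘(ℝ, E₂) ∞ F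
  inner_eq : ∀ p : M₁, ∀ u ∈ horizontalSpace (E₁ := E₁) (E₂ := E₂) F p,
    ∀ v ∈ horizontalSpace (E₁ := E₁) (E₂ := E₂) F p,
    inner ℝ (dMap (E₁ := E₁) (E₂ := E₂) F p u) (dMap (E₁ := E₁) (E₂ := E₂) F p v) = inner ℝ u v

/-- `F` is a bi-slant Riemannian map with `ξ ∈ Γ(range F_*)`: there are slant distributions
`D₁, D₂` along `F` with `range F_* = D₁ ⊕ D₂ ⊕ ⟨ξ⟩` (orthogonally) and `ψ D₁ ⊥ D₂`,
`ψ D₂ ⊥ D₁`. -/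
structure IsBiSlantRiemannianMap (F : M₁ → M₂)
    (ψ : Π x : M₂, TangentSpace 𝓘(ℝ, E₂) x →L[ℝ] TangentSpace 𝓘(ℝ, E₂) x)
    (ξ : Π x : M₂, TangentSpace 𝓘(ℝ, E₂) x) : Prop
    extends IsRiemannianMap (E₁ := E₁) (E₂ := E₂) F where
  xi_mem : ∀ p : M₁, ξ (F p) ∈ rangeSpace (E₁ := E₁) (E₂ := E₂) F p
  exists_slant : ∃ (D₁ D₂ : Π p : M₁, Submodule ℝ (TangentSpace 𝓘(ℝ, E₂) (F p))) (θ₁ θ₂ : ℝ),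
    IsSlantDistribution (E₁ := E₁) F ψ D₁ θ₁ ∧ IsSlantDistribution (E₁ := E₁) F ψ D₂ θ₂ ∧
    (∀ p, D₁ p ⟂ D₂ p ∧ D₁ p ⟂ ℝ ∙ ξ (F p) ∧ D₂ p ⟂ ℝ ∙ ξ (F p)) ∧
    (∀ p, D₁ p ⊔ D₂ p ⊔ (ℝ ∙ ξ (F p)) = rangeSpace (E₁ := E₁) (E₂ := E₂) F p) ∧
    ∀ p, (D₁ p).map (ψ (F p)).toLinearMap ⟂ D₂ p ∧ (D₂ p).map (ψ (F p)).toLinearMap ⟂ D₁ p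

/-- `X ∈ Γ((ker F_*)^⊥)`: `X` is a smooth horizontal vector field on `M₁`. -/
structure IsHorizontalField (F : M₁ → M₂) (X : Π p : M₁, TangentSpace 𝓘(ℝ, E₁) p) : Prop where
  smooth : SmoothFieldOn Set.univ X
  mem : ∀ p : M₁, X p ∈ horizontalSpace (E₁ := E₁) (E₂ := E₂) F p

end Maps

end BiSlant

end

/-!
Fix `p`, put `x = F p`, and let `V₁, V₂` be sections of `Dᗮ` and `Y` a section of `D` with
`Y x = F_* X`. The two sides of the asserted identity differ exactly by `g₂(Y, ∇_{V₁} V₂)` at `x`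
(`inner_shapeOperator_sub`). Indeed, torsion-freeness and `g₂(Y, V₂) = 0` give
`g₂([V₁, Y], V₂) = -g₂(Y, ∇_{V₁} V₂) - g₂(∇_Y V₁, V₂)`; since `η` vanishes on `V₁` and `V₂` at `x`,
the Kenmotsu condition gives `g₂(∇_Y V₁, V₂) = g₂(∇_Y (ψ V₁), ψ V₂)` (`IsKenmotsu.inner_cov_psi`);
and splitting `ψ V₁`, `ψ V₂` into tangential and normal parts, with `φ V₁ = F_* Z` for
`Z = ^*F_* φ V₁`, produces the remaining terms of the identity, because `(∇F_*)(X, Z)` is normal to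
the range. So the identity for all `X, V₁, V₂` says that every `∇_{V₁} V₂` is normal to the range,
and then so is `[V₁, V₂] = ∇_{V₁} V₂ - ∇_{V₂} V₁`.

To differentiate the fields along `F` that occur, each is written as the restriction of a field on
`M₂`: as `D` is smooth, `φ V₁` and `ω V₁` are the restrictions of the `D`- and `Dᗮ`-components of
`ψ V₁`, and the pullback connection of a restriction is computed on `M₂` (`pullbackCov_comp`). A
section `A` of `D` has the horizontal lift `^*F_* A`, which is `F`-related to `A`. Normality of
`∇F_*` on horizontal vectors becomes `g₂(∇_A B, C) = g₁(∇_a b, c)` for the lifts `a, b, c` of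
sections `A, B, C` (`IsRiemannianMap.inner_cov_horizontalLift`): the difference of the two sides is
symmetric in `A, B`, as brackets of `F`-related fields are `F`-related
(`mfderiv_mlieBracket_of_related`), and antisymmetric in `B, C`, as both connections are metric.
Lifts also supply the horizontal fields with prescribed value that the converse direction needs.
-/

-- the instances on the models are shared by all lemmas of a section
set_option linter.unusedSectionVars false

namespace BiSlant

/-! ### Smoothness of vector fields and local form of a connection -/

section OneManifold

variable {E : Type*} [NormedAddCommGroup E] [NormedSpace ℝ E] [FiniteDimensional ℝ E]
  {M : Type*} [TopologicalSpace M] [ChartedSpace E M] [IsManifold 𝓘(ℝ, E) ∞ M]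

theorem contMDiffOn_matrix_det {H : Type*} [NormedAddCommGroup H] [NormedSpace ℝ H]
    {N : Type*} [TopologicalSpace N] [ChartedSpace H N] {k : ℕ} {W : Set N}
    {A : N → Matrix (Fin k) (Fin k) ℝ}
    (hA : ∀ i j, ContMDiffOn 𝓘(ℝ, H) 𝓘(ℝ) ∞ (fun y ↦ A y i j) W) :
    ContMDiffOn 𝓘(ℝ, H) 𝓘(ℝ) ∞ (fun y ↦ (A y).det) W := by
  simp only [Matrix.det_apply, Units.smul_def, zsmul_eq_mul]
  refine contMDiffOn_finsetSum fun σ _ ↦ contMDiffOn_const.mul ?_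
  exact contMDiffOn_finsetProd fun i _ ↦ hA _ _

/-- The inner product of two smooth vector fields along a map `f` is smooth. -/
theorem contMDiffOn_inner
    [RiemannianBundle (fun x : M ↦ TangentSpace 𝓘(ℝ, E) x)]
    [IsContMDiffRiemannianBundle 𝓘(ℝ, E) ∞ E (fun x : M ↦ TangentSpace 𝓘(ℝ, E) x)]
    {H : Type*} [NormedAddCommGroup H] [NormedSpace ℝ H]
    {N : Type*} [TopologicalSpace N] [ChartedSpace H N] {W : Set N} {f : N → M}
    {u v : Π q : N, TangentSpace 𝓘(ℝ, E) (f q)}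
    (hu : ContMDiffOn 𝓘(ℝ, H) (𝓘(ℝ, E).prod 𝓘(ℝ, E)) ∞
      (fun q ↦ (⟨f q, u q⟩ : TotalSpace E (fun x : M ↦ TangentSpace 𝓘(ℝ, E) x))) W)
    (hv : ContMDiffOn 𝓘(ℝ, H) (𝓘(ℝ, E).prod 𝓘(ℝ, E)) ∞
      (fun q ↦ (⟨f q, v q⟩ : TotalSpace E (fun x : M ↦ TangentSpace 𝓘(ℝ, E) x))) W) :
    ContMDiffOn 𝓘(ℝ, H) 𝓘(ℝ) ∞ (fun q ↦ (inner ℝ (u q) (v q) : ℝ)) W :=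
  ContMDiffOn.inner_bundle (E := fun x : M ↦ TangentSpace 𝓘(ℝ, E) x) (b := f) hu hv

/-- A section of the span of a smooth frame is smooth if its inner products with the frame are: its
coefficients solve a linear system with the invertible Gram matrix of the frame, so Cramer's rule
expresses them through determinants. -/
theorem smoothFieldOn_of_inner_frame
    [RiemannianBundle (fun x : M ↦ TangentSpace 𝓘(ℝ, E) x)]
    [IsContMDiffRiemannianBundle 𝓘(ℝ, E) ∞ E (fun x : M ↦ TangentSpace 𝓘(ℝ, E) x)]
    {W : Set M} {k : ℕ} {s : Fin k → Π y : M, TangentSpace 𝓘(ℝ, E) y}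
    (hs : ∀ i, SmoothFieldOn W (s i))
    (hli : ∀ y ∈ W, LinearIndependent ℝ (fun i ↦ s i y))
    {V : Π y : M, TangentSpace 𝓘(ℝ, E) y}
    (hV : ∀ y ∈ W, V y ∈ Submodule.span ℝ (Set.range fun i ↦ s i y))
    (hin : ∀ i, ContMDiffOn 𝓘(ℝ, E) 𝓘(ℝ) ∞ (fun y ↦ (inner ℝ (s i y) (V y) : ℝ)) W) :
    SmoothFieldOn W V := by
  let A : M → Matrix (Fin k) (Fin k) ℝ := fun y ↦ Matrix.gram ℝ (fun i ↦ s i y)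
  let b : M → Fin k → ℝ := fun y i ↦ inner ℝ (s i y) (V y)
  have hA : ∀ i j, ContMDiffOn 𝓘(ℝ, E) 𝓘(ℝ) ∞ (fun y ↦ A y i j) W := fun i j ↦
    contMDiffOn_inner (hs i) (hs j)
  have hc : ∀ i, ContMDiffOn 𝓘(ℝ, E) 𝓘(ℝ) ∞
      (fun y ↦ (A y).det⁻¹ * (A y).cramer (b y) i) W := by
    intro i
    refine ContMDiffOn.mul ?_ ?_
    · refine (contMDiffOn_matrix_det hA).inv₀ fun y hy ↦ ?_
      exact ((Matrix.posDef_gram_of_linearIndependent (hli y hy)).det_pos).ne'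
    · simp only [Matrix.cramer_apply]
      refine contMDiffOn_matrix_det fun l j ↦ ?_
      simp only [Matrix.updateCol_apply]
      split_ifs
      · exact hin l
      · exact hA l j
  have hsum : SmoothFieldOn W
      (fun y ↦ ∑ i, ((A y).det⁻¹ * (A y).cramer (b y) i) • s i y) :=
    ContMDiffOn.sum_section fun i _ ↦ (hc i).smul_section (hs i)
  refine hsum.congr fun y hy ↦ ?_
  congr 1
  obtain ⟨c, hcV⟩ := (Submodule.mem_span_range_iff_exists_fun ℝ).1 (hV y hy)
  have hb : b y = (A y).mulVec c := by
    ext i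
    simp only [b, A, ← hcV, inner_sum, inner_smul_right, Matrix.mulVec, dotProduct,
      Matrix.gram_apply]
    exact Finset.sum_congr rfl fun j _ ↦ mul_comm _ _
  have hdet : (A y).det ≠ 0 :=
    ((Matrix.posDef_gram_of_linearIndependent (hli y hy)).det_pos).ne'
  have hcr : (A y).cramer (b y) = (A y).det • c := by
    rw [hb, Matrix.cramer_eq_adjugate_mulVec, Matrix.mulVec_mulVec, Matrix.adjugate_mul,
      Matrix.smul_mulVec, Matrix.one_mulVec]
  rw [← hcV]
  refine Finset.sum_congr rfl fun i _ ↦ ?_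
  rw [hcr, Pi.smul_apply, smul_eq_mul, inv_mul_cancel_left₀ hdet]

theorem smoothFieldOn_orthogonalProjection
    [RiemannianBundle (fun x : M ↦ TangentSpace 𝓘(ℝ, E) x)]
    [IsContMDiffRiemannianBundle 𝓘(ℝ, E) ∞ E (fun x : M ↦ TangentSpace 𝓘(ℝ, E) x)]
    {U : Set M} {D : Π x : M, Submodule ℝ (TangentSpace 𝓘(ℝ, E) x)}
    (hU : IsOpen U) (hD : IsSmoothDistributionOn U D) {V : Π y : M, TangentSpace 𝓘(ℝ, E) y}
    (hV : SmoothFieldOn U V) : SmoothFieldOn U (fun x ↦ (D x).starProjection (V x)) := by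
  intro x hx
  obtain ⟨W, hW, hxW, k, s, hs, hsD⟩ := hD x hx
  have hproj : SmoothFieldOn (W ∩ U) (fun x ↦ (D x).starProjection (V x)) := by
    refine smoothFieldOn_of_inner_frame (s := s) (fun i ↦ (hs i).mono Set.inter_subset_left)
      (fun y hy ↦ (hsD y hy.1).1) (fun y hy ↦ ?_) (fun i ↦ ?_)
    · rw [(hsD y hy.1).2]
      exact Submodule.starProjection_apply_mem _ _
    · refine ContMDiffOn.congr (contMDiffOn_inner ((hs i).mono Set.inter_subset_left)
        (hV.mono Set.inter_subset_right)) fun y hy ↦ ?_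
      have hmem : s i y ∈ D y := by
        rw [← (hsD y hy.1).2]
        exact Submodule.subset_span ⟨i, rfl⟩
      rw [← Submodule.inner_starProjection_left_eq_right,
        Submodule.starProjection_eq_self_iff.2 hmem]
  exact (hproj.contMDiffAt ((hW.inter hU).mem_nhds ⟨hxW, hx⟩)).contMDiffWithinAt

/-- Every vector of a smooth distribution extends to a section: extend it in a local frame with
constant coefficients and cut off by a bump function. -/
theorem exists_isSectionOn [T2Space M]
    {U : Set M} {D : Π x : M, Submodule ℝ (TangentSpace 𝓘(ℝ, E) x)}
    (hD : IsSmoothDistributionOn U D) {x : M} (hx : x ∈ U) {v : TangentSpace 𝓘(ℝ, E) x}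
    (hv : v ∈ D x) : ∃ V, IsSectionOn U D V ∧ V x = v := by
  obtain ⟨W, hW, hxW, k, s, hs, hsD⟩ := hD x hx
  obtain ⟨c, hc⟩ := (Submodule.mem_span_range_iff_exists_fun ℝ).1 ((hsD x hxW).2 ▸ hv)
  obtain ⟨f, -, hf⟩ := (SmoothBumpFunction.nhds_basis_tsupport (I := 𝓘(ℝ, E)) x).mem_iff.1
    (hW.mem_nhds hxW)
  have hsum : SmoothFieldOn W (fun y ↦ ∑ i, c i • s i y) :=
    ContMDiffOn.sum_section fun i _ ↦ (hs i).const_smul_section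
  refine ⟨fun y ↦ f y • ∑ i, c i • s i y, ⟨?_, fun y hy ↦ ?_⟩, ?_⟩
  · exact (ContMDiffOn.smul_section_of_tsupport f.contMDiff.contMDiffOn hW hf hsum).contMDiffOn
  · by_cases hyW : y ∈ W
    · refine Submodule.smul_mem _ _ (Submodule.sum_mem _ fun i _ ↦ Submodule.smul_mem _ _ ?_)
      rw [← (hsD y hyW).2]
      exact Submodule.subset_span ⟨i, rfl⟩
    · have : f y = 0 := image_eq_zero_of_notMem_tsupport fun h ↦ hyW (hf h)
      simp [this]
  · simp [hc]

/-- The local formula for a connection, with the differential of the coordinate expression of `W`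
and the derivative of the field with constant coordinates. The difference of `∇ W` and the
coordinate derivative of `W` is tensorial in `W`, so it may be evaluated on the field with constant
coordinates. -/
theorem cov_eq_of_trivialization
    (cov : CovariantDerivative 𝓘(ℝ, E) E (fun x : M ↦ TangentSpace 𝓘(ℝ, E) x))
    {W : Π x : M, TangentSpace 𝓘(ℝ, E) x} {x : M}
    (hW : MDifferentiableAt 𝓘(ℝ, E) (𝓘(ℝ, E).prod 𝓘(ℝ, E))
      (fun x ↦ (⟨x, W x⟩ : TotalSpace E (fun x : M ↦ TangentSpace 𝓘(ℝ, E) x))) x)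
    (v : TangentSpace 𝓘(ℝ, E) x) :
    let e := trivializationAt E (fun x : M ↦ TangentSpace 𝓘(ℝ, E) x) x
    cov W x v = e.symm x (mvfderiv 𝓘(ℝ, E) (fun y ↦ (e ⟨y, W y⟩).2) x v)
      + cov (fun y ↦ e.symm y (e ⟨x, W x⟩).2) x v := by
  intro e
  have hxe : x ∈ e.baseSet := FiberBundle.mem_baseSet_trivializationAt E _ x
  have hd : ∀ {σ : Π x : M, TangentSpace 𝓘(ℝ, E) x}, MDiffAt (T% σ) x →
      MDifferentiableAt 𝓘(ℝ, E) 𝓘(ℝ, E) (fun y ↦ (e ⟨y, σ y⟩).2) x := fun {σ} hσ ↦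
    (e.mdifferentiableAt_section_iff 𝓘(ℝ, E) σ hxe).1 hσ
  have hnhds : ∀ᶠ y in 𝓝 x, y ∈ e.baseSet := e.open_baseSet.mem_nhds hxe
  have hcongr : ∀ {f g : M → E}, f =ᶠ[𝓝 x] g →
      mvfderiv 𝓘(ℝ, E) f x v = mvfderiv 𝓘(ℝ, E) g x v := fun {f g} h ↦ by
    simp only [mvfderiv, h.mfderiv_eq, ContinuousLinearMap.comp_apply]; rfl
  have key : TensorialAt 𝓘(ℝ, E) E (fun σ : Π x : M, TangentSpace 𝓘(ℝ, E) x ↦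
      cov σ x v - e.symmL ℝ x (mvfderiv 𝓘(ℝ, E) (fun y ↦ (e ⟨y, σ y⟩).2) x v)) x := by
    refine ⟨fun {f σ} hf hσ ↦ ?_, fun {σ σ'} hσ hσ' ↦ ?_⟩
    · have h1 : (fun y ↦ (e ⟨y, (f • σ) y⟩).2) =ᶠ[𝓝 x] fun y ↦ f y • (e ⟨y, σ y⟩).2 := by
        filter_upwards [hnhds] with y hy
        exact (e.linear ℝ hy).map_smul (f y) (σ y)
      have h3 : e.symmL ℝ x (e ⟨x, σ x⟩).2 = σ x := by
        rw [e.symmL_apply hxe, e.symm_apply_apply_mk hxe]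
      rw [cov.isCovariantDerivativeOnUniv.leibniz hσ hf, hcongr h1, mvfderiv_fun_smul hf (hd hσ)]
      simp only [add_apply, smul_apply, ContinuousLinearMap.smulRight_apply, map_add,
        map_smul, h3]
      module
    · have h1 : (fun y ↦ (e ⟨y, (σ + σ') y⟩).2) =ᶠ[𝓝 x]
          (fun y ↦ (e ⟨y, σ y⟩).2) + fun y ↦ (e ⟨y, σ' y⟩).2 := by
        filter_upwards [hnhds] with y hy
        exact (e.linear ℝ hy).map_add (σ y) (σ' y)
      rw [cov.isCovariantDerivativeOnUniv.add hσ hσ', hcongr h1, mvfderiv_add (hd hσ) (hd hσ')]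
      simp only [add_apply, map_add]
      abel
  have hext : MDiffAt (T% (FiberBundle.extend E (W x) : Π x : M, TangentSpace 𝓘(ℝ, E) x)) x :=
    FiberBundle.mdifferentiableAt_extend ..
  have hconst : (fun y ↦ (e ⟨y, (FiberBundle.extend E (W x) :
      Π x : M, TangentSpace 𝓘(ℝ, E) x) y⟩).2) =ᶠ[𝓝 x] fun _ ↦ (e ⟨x, W x⟩).2 := by
    filter_upwards [hnhds] with y hy
    change (e ⟨y, e.symm y (e ⟨x, W x⟩).2⟩).2 = _
    rw [e.apply_mk_symm hy]
  have h := key.pointwise hW hext (FiberBundle.extend_apply_self (F := E) (W x)).symm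
  simp only [hcongr hconst, mvfderiv_const] at h
  rw [sub_eq_iff_eq_add] at h
  rw [h, ← e.symmL_apply (R := ℝ) hxe]
  simp only [zero_apply, map_zero, sub_zero]
  exact add_comm _ _

end OneManifold

/-! ### Lie brackets of related vector fields -/

section LieBracket

variable {E : Type*} [NormedAddCommGroup E] [NormedSpace ℝ E] [FiniteDimensional ℝ E]
  {M : Type*} [TopologicalSpace M] [ChartedSpace E M] [IsManifold 𝓘(ℝ, E) ∞ M]

/-- Differentiating a function along a vector field commutes with passing to the chart at `x`. -/
theorem fderiv_comp_extChartAt_symm {G : Type*} [NormedAddCommGroup G] [NormedSpace ℝ G]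
    {x : M} {h : M → G} (V : Π x : M, TangentSpace 𝓘(ℝ, E) x) {z : E}
    (hz : z ∈ (extChartAt 𝓘(ℝ, E) x).target)
    (hh : MDifferentiableAt 𝓘(ℝ, E) 𝓘(ℝ, G) h ((extChartAt 𝓘(ℝ, E) x).symm z)) :
    fderiv ℝ (h ∘ (extChartAt 𝓘(ℝ, E) x).symm) z
      (VectorField.mpullbackWithin 𝓘(ℝ, E) 𝓘(ℝ, E) (extChartAt 𝓘(ℝ, E) x).symm V
        (Set.range 𝓘(ℝ, E)) z)
      = mvfderiv 𝓘(ℝ, E) h ((extChartAt 𝓘(ℝ, E) x).symm z)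
        (V ((extChartAt 𝓘(ℝ, E) x).symm z)) := by
  have : IsManifold 𝓘(ℝ, E) 1 M := IsManifold.of_le (n := ∞) (by norm_cast)
  have hinv := isInvertible_mfderivWithin_extChartAt_symm hz
  have hd := mdifferentiableWithinAt_extChartAt_symm hz
  rw [← mfderiv_eq_fderiv, VectorField.mpullbackWithin_apply]
  simp only [modelWithCornersSelf_coe, Set.range_id, mfderivWithin_univ,
    mdifferentiableWithinAt_univ] at hinv hd ⊢
  rw [mfderiv_comp z hh hd]
  obtain ⟨A, hA⟩ := hinv
  rw [← hA]
  rw [ContinuousLinearMap.inverse_equiv]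
  exact congrArg (mfderiv 𝓘(ℝ, E) 𝓘(ℝ, G) h _) (A.apply_symm_apply _)

/-- The Lie bracket acts on vector-valued functions as the commutator of the derivations; moreover,
the derivative of `f` along `W` is again differentiable. -/
theorem mvfderiv_mlieBracket {G : Type*} [NormedAddCommGroup G] [NormedSpace ℝ G]
    {V W : Π x : M, TangentSpace 𝓘(ℝ, E) x} {x : M} {f : M → G}
    (hf : ContMDiffAt 𝓘(ℝ, E) 𝓘(ℝ, G) ∞ f x) (hV : MDiffAt (T% V) x) (hW : MDiffAt (T% W) x) :
    MDifferentiableAt 𝓘(ℝ, E) 𝓘(ℝ, G) (fun y ↦ mvfderiv 𝓘(ℝ, E) f y (W y)) x ∧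
    mvfderiv 𝓘(ℝ, E) f x (VectorField.mlieBracket 𝓘(ℝ, E) V W x)
      = mvfderiv 𝓘(ℝ, E) (fun y ↦ mvfderiv 𝓘(ℝ, E) f y (W y)) x (V x)
        - mvfderiv 𝓘(ℝ, E) (fun y ↦ mvfderiv 𝓘(ℝ, E) f y (V y)) x (W x) := by
  have : IsManifold 𝓘(ℝ, E) 1 M := IsManifold.of_le (n := ∞) (by norm_cast)
  have : IsManifold 𝓘(ℝ, E) 2 M := IsManifold.of_le (n := ∞) (by norm_cast)
  set φ := extChartAt 𝓘(ℝ, E) x with hφ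
  have hxφ : φ.symm (φ x) = x := extChartAt_to_inv x
  have htar : φ.target ∈ 𝓝 (φ x) := extChartAt_target_mem_nhds x
  let pb (V : Π x : M, TangentSpace 𝓘(ℝ, E) x) : E → E :=
    VectorField.mpullbackWithin 𝓘(ℝ, E) 𝓘(ℝ, E) φ.symm V (Set.range 𝓘(ℝ, E))
  have hpbd : ∀ {V : Π x : M, TangentSpace 𝓘(ℝ, E) x}, MDiffAt (T% V) x →
      DifferentiableAt ℝ (pb V) (φ x) := fun {V} hV ↦ by
    have h : DifferentiableWithinAt ℝ (pb V) (φ.symm ⁻¹' Set.univ ∩ Set.range 𝓘(ℝ, E)) (φ x) :=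
      MDifferentiableWithinAt.differentiableWithinAt_mpullbackWithin_vectorField
        (mdifferentiableWithinAt_univ.2 hV)
    rwa [Set.preimage_univ, Set.univ_inter, modelWithCornersSelf_coe, Set.range_id,
      differentiableWithinAt_univ] at h
  let g : E → G := f ∘ φ.symm
  have hg : ContDiffAt ℝ ∞ g (φ x) := by
    rw [← contMDiffAt_iff_contDiffAt]
    exact ContMDiffAt.comp_of_eq hf
      ((contMDiffOn_extChartAt_symm x).contMDiffAt htar) hxφ
  have key := VectorField.fderiv_apply_lieBracket hg (by simp; norm_cast) (hpbd hW) (hpbd hV)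
  have hfd : ∀ᶠ z in 𝓝 (φ x), MDifferentiableAt 𝓘(ℝ, E) 𝓘(ℝ, G) f (φ.symm z) := by
    have h1 : ∀ᶠ y in 𝓝 x, MDifferentiableAt 𝓘(ℝ, E) 𝓘(ℝ, G) f y :=
      ((contMDiffAt_iff_contMDiffAt_nhds (by simp)).1 (hf.of_le (m := 1) (by norm_cast))).mono
        fun y hy ↦ hy.mdifferentiableAt one_ne_zero
    have h2 := continuousAt_extChartAt_symm (I := 𝓘(ℝ, E)) x
    exact h2.eventually (by rwa [extChartAt_to_inv])
  -- in the chart, the function `d f (V)` reads `d g (pb V)`, where `pb V` is `V` in the chart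
  have hpb : ∀ (V : Π x : M, TangentSpace 𝓘(ℝ, E) x),
      (fun z ↦ fderiv ℝ g z (pb V z)) =ᶠ[𝓝 (φ x)]
        (fun y ↦ mvfderiv 𝓘(ℝ, E) f y (V y)) ∘ φ.symm := by
    intro V
    filter_upwards [htar, hfd] with z hz hzf
    exact fderiv_comp_extChartAt_symm V hz hzf
  have hhd : ∀ {V : Π x : M, TangentSpace 𝓘(ℝ, E) x}, MDiffAt (T% V) x →
      MDifferentiableAt 𝓘(ℝ, E) 𝓘(ℝ, G) (fun y ↦ mvfderiv 𝓘(ℝ, E) f y (V y)) x := by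
    intro V hV
    have h1 : DifferentiableAt ℝ ((fun y ↦ mvfderiv 𝓘(ℝ, E) f y (V y)) ∘ φ.symm) (φ x) :=
      (hpb V).differentiableAt_iff.1
        (((hg.fderiv_right (m := 1) (by norm_cast)).differentiableAt one_ne_zero).clm_apply
          (hpbd hV))
    have h2 := h1.mdifferentiableAt.comp x
      (mdifferentiableAt_extChartAt (I := 𝓘(ℝ, E)) (mem_chart_source E x))
    refine h2.congr_of_eventuallyEq ?_
    filter_upwards [extChartAt_source_mem_nhds (I := 𝓘(ℝ, E)) x] with y hy
    simp only [Function.comp_apply]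
    rw [φ.left_inv hy]
  have hder : ∀ {h : M → G} (V : Π x : M, TangentSpace 𝓘(ℝ, E) x),
      MDifferentiableAt 𝓘(ℝ, E) 𝓘(ℝ, G) h x →
      fderiv ℝ (h ∘ φ.symm) (φ x) (pb V (φ x)) = mvfderiv 𝓘(ℝ, E) h x (V x) := by
    intro h V hh
    refine (fderiv_comp_extChartAt_symm V (mem_extChartAt_target x)
      (by rwa [extChartAt_to_inv])).trans ?_
    exact congrArg (fun y ↦ mvfderiv 𝓘(ℝ, E) h y (V y)) hxφ
  rw [(hpb V).fderiv_eq, (hpb W).fderiv_eq, hder _ (hhd hV), hder _ (hhd hW)] at key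
  refine ⟨hhd hW, ?_⟩
  rw [← key]
  have hfg : f =ᶠ[𝓝 x] g ∘ φ := by
    filter_upwards [extChartAt_source_mem_nhds (I := 𝓘(ℝ, E)) x] with y hy
    simp only [Function.comp_apply, g]
    rw [φ.left_inv hy]
  obtain ⟨A, hA⟩ := isInvertible_mfderiv_extChartAt (I := 𝓘(ℝ, E)) (mem_extChartAt_source x)
  let L : E := VectorField.lieBracket ℝ (pb V) (pb W) (φ x)
  have hLw : VectorField.lieBracketWithin ℝ (pb V) (pb W)
      (φ.symm ⁻¹' Set.univ ∩ Set.range 𝓘(ℝ, E)) (φ x) = L := by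
    rw [Set.preimage_univ, Set.univ_inter, modelWithCornersSelf_coe, Set.range_id,
      VectorField.lieBracketWithin_univ]
  have hL : VectorField.mlieBracket 𝓘(ℝ, E) V W x = A.symm L := by
    rw [← VectorField.mlieBracketWithin_univ, VectorField.mlieBracketWithin_apply, ← hA,
      ContinuousLinearMap.inverse_equiv]
    exact congrArg A.symm hLw
  have hcomp : mfderiv 𝓘(ℝ, E) 𝓘(ℝ, G) f x
      = (mfderiv 𝓘(ℝ, E) 𝓘(ℝ, G) g (φ x)).comp (mfderiv 𝓘(ℝ, E) 𝓘(ℝ, E) φ x) := by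
    rw [hfg.mfderiv_eq]
    exact mfderiv_comp x (hg.differentiableAt (by simp)).mdifferentiableAt
      (mdifferentiableAt_extChartAt (I := 𝓘(ℝ, E)) (mem_chart_source E x))
  rw [hL]
  change mfderiv 𝓘(ℝ, E) 𝓘(ℝ, G) f x _ = _
  rw [hcomp, ← hA, ← mfderiv_eq_fderiv]
  exact congrArg (mfderiv 𝓘(ℝ, E) 𝓘(ℝ, G) g (φ x)) (A.apply_symm_apply L)

/-- The Lie bracket of `F`-related vector fields is `F`-related. Both sides are compared after
applying a chart `φ` around `F p`, where they are the commutators of derivations acting on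
`φ ∘ F` and on `φ`. -/
theorem mfderiv_mlieBracket_of_related
    {E' : Type*} [NormedAddCommGroup E'] [NormedSpace ℝ E'] [FiniteDimensional ℝ E']
    {M' : Type*} [TopologicalSpace M'] [ChartedSpace E' M'] [IsManifold 𝓘(ℝ, E') ∞ M']
    {F : M → M'} {p : M} (hF : ContMDiffAt 𝓘(ℝ, E) 𝓘(ℝ, E') ∞ F p)
    {a b : Π q : M, TangentSpace 𝓘(ℝ, E) q} {A B : Π x : M', TangentSpace 𝓘(ℝ, E') x}
    (ha : MDiffAt (T% a) p) (hb : MDiffAt (T% b) p)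
    (hA : MDiffAt (T% A) (F p)) (hB : MDiffAt (T% B) (F p))
    (haA : ∀ᶠ q in 𝓝 p, mfderiv 𝓘(ℝ, E) 𝓘(ℝ, E') F q (a q) = A (F q))
    (hbB : ∀ᶠ q in 𝓝 p, mfderiv 𝓘(ℝ, E) 𝓘(ℝ, E') F q (b q) = B (F q)) :
    mfderiv 𝓘(ℝ, E) 𝓘(ℝ, E') F p (VectorField.mlieBracket 𝓘(ℝ, E) a b p)
      = VectorField.mlieBracket 𝓘(ℝ, E') A B (F p) := by
  have : IsManifold 𝓘(ℝ, E') 1 M' := IsManifold.of_le (n := ∞) (by norm_cast)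
  set φ := extChartAt 𝓘(ℝ, E') (F p) with hφ
  have hφs : ContMDiffAt 𝓘(ℝ, E') 𝓘(ℝ, E') ∞ φ (F p) := contMDiffAt_extChartAt
  have hFd : ∀ᶠ q in 𝓝 p, MDifferentiableAt 𝓘(ℝ, E) 𝓘(ℝ, E') F q :=
    ((contMDiffAt_iff_contMDiffAt_nhds (by simp)).1 (hF.of_le (m := 1) (by norm_cast))).mono
      fun y hy ↦ hy.mdifferentiableAt one_ne_zero
  have hφd : ∀ᶠ q in 𝓝 p, MDifferentiableAt 𝓘(ℝ, E') 𝓘(ℝ, E') φ (F q) :=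
    hF.continuousAt.eventually
      (((contMDiffAt_iff_contMDiffAt_nhds (by simp)).1 (hφs.of_le (m := 1) (by norm_cast))).mono
        fun y hy ↦ hy.mdifferentiableAt one_ne_zero)
  have hchain : ∀ (h : M' → E') (q : M), MDifferentiableAt 𝓘(ℝ, E') 𝓘(ℝ, E') h (F q) →
      MDifferentiableAt 𝓘(ℝ, E) 𝓘(ℝ, E') F q → ∀ u : TangentSpace 𝓘(ℝ, E) q,
      mvfderiv 𝓘(ℝ, E) (h ∘ F) q u
        = mvfderiv 𝓘(ℝ, E') h (F q) (mfderiv 𝓘(ℝ, E) 𝓘(ℝ, E') F q u) := by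
    intro h q hh hF u
    change mfderiv 𝓘(ℝ, E) 𝓘(ℝ, E') (h ∘ F) q u = _
    rw [mfderiv_comp q hh hF]
    rfl
  have hrel : ∀ {a : Π q : M, TangentSpace 𝓘(ℝ, E) q} {A : Π x : M', TangentSpace 𝓘(ℝ, E') x},
      (∀ᶠ q in 𝓝 p, mfderiv 𝓘(ℝ, E) 𝓘(ℝ, E') F q (a q) = A (F q)) →
      (fun q ↦ mvfderiv 𝓘(ℝ, E) (φ ∘ F) q (a q))
        =ᶠ[𝓝 p] (fun x ↦ mvfderiv 𝓘(ℝ, E') φ x (A x)) ∘ F := by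
    intro a A h
    filter_upwards [h, hFd, hφd] with q hq h1 h2
    rw [hchain φ q h2 h1, hq]
    rfl
  have hder : ∀ {a b : Π q : M, TangentSpace 𝓘(ℝ, E) q}
      {A B : Π x : M', TangentSpace 𝓘(ℝ, E') x},
      (∀ᶠ q in 𝓝 p, mfderiv 𝓘(ℝ, E) 𝓘(ℝ, E') F q (a q) = A (F q)) →
      (∀ᶠ q in 𝓝 p, mfderiv 𝓘(ℝ, E) 𝓘(ℝ, E') F q (b q) = B (F q)) →
      MDiffAt (T% B) (F p) →
      mvfderiv 𝓘(ℝ, E) (fun q ↦ mvfderiv 𝓘(ℝ, E) (φ ∘ F) q (b q)) p (a p)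
        = mvfderiv 𝓘(ℝ, E') (fun x ↦ mvfderiv 𝓘(ℝ, E') φ x (B x)) (F p) (A (F p)) := by
    intro a b A B ha hb hB
    rw [← ha.self_of_nhds, ← hchain _ p (mvfderiv_mlieBracket hφs hB hB).1 hFd.self_of_nhds]
    exact DFunLike.congr_fun ((hrel hb).mfderiv_eq (I := 𝓘(ℝ, E)) (I' := 𝓘(ℝ, E'))) (a p)
  -- evaluate the commutator formula for `φ ∘ F` on `M` and for `φ` on `M'`
  have h1 := (mvfderiv_mlieBracket (hφs.comp p hF) ha hb).2
  have h2 := (mvfderiv_mlieBracket hφs hA hB).2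
  rw [hder haA hbB hB, hder hbB haA hA, ← h2, hchain φ p hφd.self_of_nhds hFd.self_of_nhds] at h1
  obtain ⟨e, he⟩ := isInvertible_mfderiv_extChartAt (I := 𝓘(ℝ, E'))
    (mem_extChartAt_source (I := 𝓘(ℝ, E')) (F p))
  apply e.injective
  have h3 : ∀ w, e w = mfderiv 𝓘(ℝ, E') 𝓘(ℝ, E') φ (F p) w := fun w ↦ by rw [← he]; rfl
  rw [h3, h3]
  exact h1

end LieBracket

/-! ### The pullback connection and the adjoint of the differential -/

section Maps

variable {E₁ : Type*} [NormedAddCommGroup E₁] [NormedSpace ℝ E₁] [FiniteDimensional ℝ E₁]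
  {M₁ : Type*} [TopologicalSpace M₁] [ChartedSpace E₁ M₁] [IsManifold 𝓘(ℝ, E₁) ∞ M₁]
  {E₂ : Type*} [NormedAddCommGroup E₂] [NormedSpace ℝ E₂] [FiniteDimensional ℝ E₂]
  {M₂ : Type*} [TopologicalSpace M₂] [ChartedSpace E₂ M₂] [IsManifold 𝓘(ℝ, E₂) ∞ M₂]

/-- For the restriction of a field `W` on `M₂`, the pullback connection is `∇^F_u W = ∇_{F_* u} W`. -/
theorem pullbackCov_comp
    (cov : CovariantDerivative 𝓘(ℝ, E₂) E₂ (fun x : M₂ ↦ TangentSpace 𝓘(ℝ, E₂) x))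
    {F : M₁ → M₂} {p : M₁} (hF : MDifferentiableAt 𝓘(ℝ, E₁) 𝓘(ℝ, E₂) F p)
    {W : Π x : M₂, TangentSpace 𝓘(ℝ, E₂) x} (hW : MDiffAt (T% W) (F p))
    (u : TangentSpace 𝓘(ℝ, E₁) p) :
    pullbackCov cov F (fun q ↦ W (F q)) p u = cov W (F p) (dMap (E₁ := E₁) (E₂ := E₂) F p u) := by
  rw [cov_eq_of_trivialization cov hW]
  set e := trivializationAt E₂ (fun x : M₂ ↦ TangentSpace 𝓘(ℝ, E₂) x) (F p) with he
  have hd : MDifferentiableAt 𝓘(ℝ, E₂) 𝓘(ℝ, E₂) (fun y ↦ (e ⟨y, W y⟩).2) (F p) :=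
    (e.mdifferentiableAt_section_iff 𝓘(ℝ, E₂) W
      (FiberBundle.mem_baseSet_trivializationAt E₂ _ (F p))).1 hW
  have hc := DFunLike.congr_fun (mfderiv_comp p hd hF) u
  simp only [pullbackCov]
  exact congrArg (fun w : E₂ ↦ e.symm (F p) w + cov (fun y ↦ e.symm y (e ⟨F p, W (F p)⟩).2) (F p)
    (dMap (E₁ := E₁) (E₂ := E₂) F p u)) hc

variable [RiemannianBundle (fun x : M₁ ↦ TangentSpace 𝓘(ℝ, E₁) x)]
  [RiemannianBundle (fun x : M₂ ↦ TangentSpace 𝓘(ℝ, E₂) x)]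

theorem inner_adjointMap (F : M₁ → M₂) (p : M₁) (u : TangentSpace 𝓘(ℝ, E₁) p)
    (v : TangentSpace 𝓘(ℝ, E₂) (F p)) :
    (inner ℝ u (adjointMap (E₁ := E₁) F p v) : ℝ) = inner ℝ (dMap (E₁ := E₁) (E₂ := E₂) F p u) v :=
  LinearMap.adjoint_inner_right _ _ _

theorem adjointMap_mem_horizontalSpace (F : M₁ → M₂) (p : M₁)
    (v : TangentSpace 𝓘(ℝ, E₂) (F p)) :
    adjointMap (E₁ := E₁) F p v ∈ horizontalSpace (E₁ := E₁) (E₂ := E₂) F p := by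
  intro u hu
  rw [inner_adjointMap, show dMap (E₁ := E₁) (E₂ := E₂) F p u = 0 from hu, inner_zero_left]

theorem IsRiemannianMap.adjointMap_dMap {F : M₁ → M₂}
    (hF : IsRiemannianMap (E₁ := E₁) (E₂ := E₂) F) {p : M₁} {u : TangentSpace 𝓘(ℝ, E₁) p}
    (hu : u ∈ horizontalSpace (E₁ := E₁) (E₂ := E₂) F p) :
    adjointMap (E₁ := E₁) F p (dMap (E₁ := E₁) (E₂ := E₂) F p u) = u := by
  have hmem := adjointMap_mem_horizontalSpace (E₁ := E₁) F p (dMap (E₁ := E₁) (E₂ := E₂) F p u)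
  have hsub := Submodule.sub_mem _ hmem hu
  rw [← sub_eq_zero, ← inner_self_eq_zero (𝕜 := ℝ), inner_sub_right, inner_adjointMap,
    hF.inner_eq p _ hsub _ hu, sub_self]

theorem exists_horizontal (F : M₁ → M₂) (p : M₁) {v : TangentSpace 𝓘(ℝ, E₂) (F p)}
    (hv : v ∈ rangeSpace (E₁ := E₁) F p) :
    ∃ u ∈ horizontalSpace (E₁ := E₁) (E₂ := E₂) F p, dMap (E₁ := E₁) (E₂ := E₂) F p u = v := by
  obtain ⟨w, rfl⟩ := hv
  set K := LinearMap.ker (dMap (E₁ := E₁) (E₂ := E₂) F p).toLinearMap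
  refine ⟨w - K.starProjection w, Submodule.sub_starProjection_mem_orthogonal w, ?_⟩
  have hk : dMap (E₁ := E₁) (E₂ := E₂) F p (K.starProjection w) = 0 :=
    Submodule.starProjection_apply_mem K w
  rw [map_sub, hk, sub_zero]
  rfl

theorem IsRiemannianMap.dMap_adjointMap {F : M₁ → M₂}
    (hF : IsRiemannianMap (E₁ := E₁) (E₂ := E₂) F) {p : M₁} {v : TangentSpace 𝓘(ℝ, E₂) (F p)}
    (hv : v ∈ rangeSpace (E₁ := E₁) F p) :
    dMap (E₁ := E₁) (E₂ := E₂) F p (adjointMap (E₁ := E₁) F p v) = v := by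
  obtain ⟨u, hu, rfl⟩ := exists_horizontal F p hv
  rw [hF.adjointMap_dMap hu]

/-- The adjoint of `F_*` takes smooth fields along `F` to smooth fields: the inner product of
`^*F_* W` with a local frame field `e_i` is `g₂(F_* e_i, W)`. -/
theorem smoothFieldOn_adjointMap
    [IsContMDiffRiemannianBundle 𝓘(ℝ, E₁) ∞ E₁ (fun x : M₁ ↦ TangentSpace 𝓘(ℝ, E₁) x)]
    [IsContMDiffRiemannianBundle 𝓘(ℝ, E₂) ∞ E₂ (fun x : M₂ ↦ TangentSpace 𝓘(ℝ, E₂) x)]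
    {F : M₁ → M₂} (hF : ContMDiff 𝓘(ℝ, E₁) 𝓘(ℝ, E₂) ∞ F)
    {W : Π q : M₁, TangentSpace 𝓘(ℝ, E₂) (F q)} (hW : SmoothAlongOn (E₁ := E₁) F Set.univ W) :
    SmoothFieldOn Set.univ (fun q ↦ adjointMap (E₁ := E₁) F q (W q)) := by
  intro p _
  set e := trivializationAt E₁ (fun x : M₁ ↦ TangentSpace 𝓘(ℝ, E₁) x) p
  have hpe : p ∈ e.baseSet := FiberBundle.mem_baseSet_trivializationAt E₁ _ p
  let b := Module.finBasis ℝ E₁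
  have hs : ∀ i, SmoothFieldOn e.baseSet (e.localFrame b i) := fun i ↦
    e.contMDiffOn_localFrame_baseSet ∞ b i
  have hloc : SmoothFieldOn e.baseSet (fun q ↦ adjointMap (E₁ := E₁) F q (W q)) := by
    have hfr := e.isLocalFrameOn_localFrame_baseSet 𝓘(ℝ, E₁) ∞ b
    refine smoothFieldOn_of_inner_frame hs (fun q hq ↦ hfr.linearIndependent hq)
      (fun q hq ↦ hfr.generating hq Submodule.mem_top) fun i ↦ ?_
    simp only [inner_adjointMap]
    refine contMDiffOn_inner ?_ (hW.mono (Set.subset_univ _))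
    exact (hF.contMDiff_tangentMap (m := ∞) (by simp)).comp_contMDiffOn (hs i)
  exact (hloc.contMDiffAt (e.open_baseSet.mem_nhds hpe)).contMDiffWithinAt

end Maps

/-! ### Connections in Kenmotsu manifolds and under Riemannian maps -/

section OneManifold

variable {E : Type*} [NormedAddCommGroup E] [NormedSpace ℝ E] [FiniteDimensional ℝ E]
  {M : Type*} [TopologicalSpace M] [ChartedSpace E M] [IsManifold 𝓘(ℝ, E) ∞ M]

theorem SmoothFieldOn.mdifferentiableAt {U : Set M} {V : Π x : M, TangentSpace 𝓘(ℝ, E) x}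
    (hV : SmoothFieldOn U V) {x : M} (hU : U ∈ 𝓝 x) : MDiffAt (T% V) x :=
  (ContMDiffOn.contMDiffAt hV hU).mdifferentiableAt (by simp)

variable [RiemannianBundle (fun x : M ↦ TangentSpace 𝓘(ℝ, E) x)]
  [IsContMDiffRiemannianBundle 𝓘(ℝ, E) ∞ E (fun x : M ↦ TangentSpace 𝓘(ℝ, E) x)]

theorem mdifferentiableAt_inner {V W : Π x : M, TangentSpace 𝓘(ℝ, E) x} {x : M}
    (hV : MDiffAt (T% V) x) (hW : MDiffAt (T% W) x) :
    MDifferentiableAt 𝓘(ℝ, E) 𝓘(ℝ) (fun y ↦ (inner ℝ (V y) (W y) : ℝ)) x :=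
  MDifferentiableAt.inner_bundle (IB := 𝓘(ℝ, E)) (E := fun x : M ↦ TangentSpace 𝓘(ℝ, E) x)
    (b := fun y ↦ y) hV hW

theorem IsLeviCivita.inner_cov_of_orthogonal
    {cov : CovariantDerivative 𝓘(ℝ, E) E (fun x : M ↦ TangentSpace 𝓘(ℝ, E) x)}
    (hcov : IsLeviCivita cov) {V W : Π x : M, TangentSpace 𝓘(ℝ, E) x} {x : M}
    (hV : MDiffAt (T% V) x) (hW : MDiffAt (T% W) x)
    (h : ∀ᶠ y in 𝓝 x, (inner ℝ (V y) (W y) : ℝ) = 0) (u : TangentSpace 𝓘(ℝ, E) x) :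
    (inner ℝ (cov V x u) (W x) : ℝ) = -inner ℝ (V x) (cov W x u) := by
  have h1 := hcov.metric V W x hV hW u
  have h2 : (fun y ↦ (inner ℝ (V y) (W y) : ℝ)) =ᶠ[𝓝 x] fun _ ↦ 0 := h
  have h3 : (mfderiv 𝓘(ℝ, E) 𝓘(ℝ, ℝ) (fun y ↦ (inner ℝ (V y) (W y) : ℝ)) x u : ℝ) = 0 := by
    rw [h2.mfderiv_eq, mfderiv_const]
    rfl
  exact eq_neg_of_add_eq_zero_left (h1.symm.trans h3)

theorem IsAlmostContactMetric.smoothFieldOn_psi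
    {ψ : Π x : M, TangentSpace 𝓘(ℝ, E) x →L[ℝ] TangentSpace 𝓘(ℝ, E) x}
    {ξ : Π x : M, TangentSpace 𝓘(ℝ, E) x} {η : Π x : M, TangentSpace 𝓘(ℝ, E) x →L[ℝ] ℝ}
    (h : IsAlmostContactMetric ψ ξ η) {U : Set M} {V : Π x : M, TangentSpace 𝓘(ℝ, E) x}
    (hV : SmoothFieldOn U V) : SmoothFieldOn U (fun x ↦ ψ x (V x)) :=
  ContMDiffOn.clm_bundle_apply (E₁ := fun x : M ↦ TangentSpace 𝓘(ℝ, E) x)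
    (E₂ := fun x : M ↦ TangentSpace 𝓘(ℝ, E) x) h.smooth_psi.contMDiffOn hV

/-- In a Kenmotsu manifold, `g(∇_u (ψ V), ψ w) = g(∇_u V, w)` at a point where `V` and `w` are
orthogonal to `ξ`: there `(∇_u ψ) V` is a multiple of `ξ`, which is orthogonal to the image of `ψ`. -/
theorem IsKenmotsu.inner_cov_psi
    {cov : CovariantDerivative 𝓘(ℝ, E) E (fun x : M ↦ TangentSpace 𝓘(ℝ, E) x)}
    {ψ : Π x : M, TangentSpace 𝓘(ℝ, E) x →L[ℝ] TangentSpace 𝓘(ℝ, E) x}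
    {ξ : Π x : M, TangentSpace 𝓘(ℝ, E) x} {η : Π x : M, TangentSpace 𝓘(ℝ, E) x →L[ℝ] ℝ}
    (hK : IsKenmotsu cov ψ ξ η) {V : Π x : M, TangentSpace 𝓘(ℝ, E) x} {x : M}
    (hV : MDiffAt (T% V) x) (hηV : η x (V x) = 0) {w : TangentSpace 𝓘(ℝ, E) x}
    (hηw : η x w = 0) (u : TangentSpace 𝓘(ℝ, E) x) :
    (inner ℝ (cov (fun y ↦ ψ y (V y)) x u) (ψ x w) : ℝ) = inner ℝ (cov V x u) w := by
  have h1 := hK.cov_psi V x hV u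
  have hξ : (inner ℝ (ξ x) (ψ x w) : ℝ) = 0 := by
    rw [real_inner_comm, ← hK.eta_eq, hK.eta_psi]
  rw [sub_eq_iff_eq_add] at h1
  rw [h1, hηV, zero_smul, sub_zero, inner_add_left, inner_smul_left, hξ, mul_zero, zero_add,
    hK.inner_psi_psi, hηw, mul_zero, sub_zero]

end OneManifold

section Maps

variable {E₁ : Type*} [NormedAddCommGroup E₁] [NormedSpace ℝ E₁] [FiniteDimensional ℝ E₁]
  {M₁ : Type*} [TopologicalSpace M₁] [ChartedSpace E₁ M₁] [IsManifold 𝓘(ℝ, E₁) ∞ M₁]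
  [RiemannianBundle (fun x : M₁ ↦ TangentSpace 𝓘(ℝ, E₁) x)]
  [IsContMDiffRiemannianBundle 𝓘(ℝ, E₁) ∞ E₁ (fun x : M₁ ↦ TangentSpace 𝓘(ℝ, E₁) x)]
  {E₂ : Type*} [NormedAddCommGroup E₂] [NormedSpace ℝ E₂] [FiniteDimensional ℝ E₂]
  {M₂ : Type*} [TopologicalSpace M₂] [ChartedSpace E₂ M₂] [IsManifold 𝓘(ℝ, E₂) ∞ M₂]
  [RiemannianBundle (fun x : M₂ ↦ TangentSpace 𝓘(ℝ, E₂) x)]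
  [IsContMDiffRiemannianBundle 𝓘(ℝ, E₂) ∞ E₂ (fun x : M₂ ↦ TangentSpace 𝓘(ℝ, E₂) x)]

/-- The horizontal lift `^*F_* A` of a vector field `A` on `M₂`. If `F` is a Riemannian map and `A` is
tangent to the range of `F_*`, it is the horizontal field that `F_*` maps to `A`. -/
noncomputable def horizontalLift (F : M₁ → M₂) (A : Π x : M₂, TangentSpace 𝓘(ℝ, E₂) x) (q : M₁) :
    TangentSpace 𝓘(ℝ, E₁) q :=
  adjointMap (E₁ := E₁) F q (A (F q))

variable {F : M₁ → M₂} {U : Set M₂} {D : Π x : M₂, Submodule ℝ (TangentSpace 𝓘(ℝ, E₂) x)}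

theorem smoothFieldOn_horizontalLift (hF : ContMDiff 𝓘(ℝ, E₁) 𝓘(ℝ, E₂) ∞ F)
    (hFU : Set.range F ⊆ U) {A : Π x : M₂, TangentSpace 𝓘(ℝ, E₂) x} (hA : SmoothFieldOn U A) :
    SmoothFieldOn Set.univ (horizontalLift (E₁ := E₁) F A) :=
  smoothFieldOn_adjointMap hF (hA.comp hF.contMDiffOn fun q _ ↦ hFU ⟨q, rfl⟩)

theorem IsRiemannianMap.dMap_horizontalLift (hF : IsRiemannianMap (E₁ := E₁) (E₂ := E₂) F)
    (hFU : Set.range F ⊆ U) (hDF : ∀ p : M₁, D (F p) = rangeSpace (E₁ := E₁) F p)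
    {A : Π x : M₂, TangentSpace 𝓘(ℝ, E₂) x} (hA : IsSectionOn U D A) (q : M₁) :
    dMap (E₁ := E₁) (E₂ := E₂) F q (horizontalLift F A q) = A (F q) :=
  hF.dMap_adjointMap (hDF q ▸ hA.mem _ (hFU ⟨q, rfl⟩))

/-- The Levi-Civita connections correspond under horizontal lifts, in the directions tangent to the
range; equivalently, `(∇F_*)(X, Y)` is normal to the range for horizontal `X, Y`. -/
theorem IsRiemannianMap.inner_cov_horizontalLift
    {cov₁ : CovariantDerivative 𝓘(ℝ, E₁) E₁ (fun x : M₁ ↦ TangentSpace 𝓘(ℝ, E₁) x)}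
    (hcov₁ : IsLeviCivita cov₁)
    {cov₂ : CovariantDerivative 𝓘(ℝ, E₂) E₂ (fun x : M₂ ↦ TangentSpace 𝓘(ℝ, E₂) x)}
    (hcov₂ : IsLeviCivita cov₂)
    (hF : IsRiemannianMap (E₁ := E₁) (E₂ := E₂) F) (hU : IsOpen U) (hFU : Set.range F ⊆ U)
    (hDF : ∀ p : M₁, D (F p) = rangeSpace (E₁ := E₁) F p)
    {A B C : Π x : M₂, TangentSpace 𝓘(ℝ, E₂) x} (hA : IsSectionOn U D A)
    (hB : IsSectionOn U D B) (hC : IsSectionOn U D C) (p : M₁) :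
    (inner ℝ (cov₂ B (F p) (A (F p))) (C (F p)) : ℝ)
      = inner ℝ (cov₁ (horizontalLift F B) p (horizontalLift F A p)) (horizontalLift F C p) := by
  let T (A B C : Π x : M₂, TangentSpace 𝓘(ℝ, E₂) x) : ℝ :=
    inner ℝ (cov₂ B (F p) (A (F p))) (C (F p))
      - inner ℝ (cov₁ (horizontalLift F B) p (horizontalLift F A p)) (horizontalLift F C p)
  have hd₂ : ∀ {A}, IsSectionOn U D A → MDiffAt (T% A) (F p) := fun h ↦
    h.smooth.mdifferentiableAt (hU.mem_nhds (hFU ⟨p, rfl⟩))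
  have hd₁ : ∀ {A}, IsSectionOn U D A → MDiffAt (T% (horizontalLift (E₁ := E₁) F A)) p := fun h ↦
    (smoothFieldOn_horizontalLift hF.smooth hFU h.smooth).mdifferentiableAt Filter.univ_mem
  have hdF : ∀ {A}, IsSectionOn U D A → ∀ q,
      dMap (E₁ := E₁) (E₂ := E₂) F q (horizontalLift F A q) = A (F q) := fun h q ↦
    hF.dMap_horizontalLift hFU hDF h q
  have hsymm : ∀ {A B C}, IsSectionOn U D A → IsSectionOn U D B → T A B C = T B A C := by
    intro A B C hA hB
    have h1 := hcov₁.torsionFree _ _ p (hd₁ hA) (hd₁ hB)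
    have h2 := hcov₂.torsionFree _ _ (F p) (hd₂ hA) (hd₂ hB)
    rw [← mfderiv_mlieBracket_of_related hF.smooth.contMDiffAt (hd₁ hA) (hd₁ hB) (hd₂ hA) (hd₂ hB)
      (.of_forall (hdF hA)) (.of_forall (hdF hB)), ← h1] at h2
    have h3 := (congrArg (fun w ↦ (inner ℝ w (C (F p)) : ℝ)) h2).trans
      (inner_adjointMap F p _ (C (F p))).symm
    simp only [inner_sub_left] at h3
    change _ = inner ℝ _ (horizontalLift F C p) - inner ℝ _ (horizontalLift F C p) at h3
    simp only [T]
    linarith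
  have hanti : ∀ {A B C}, IsSectionOn U D A → IsSectionOn U D B → IsSectionOn U D C →
      T A B C = -T A C B := by
    intro A B C hA hB hC
    have h1 := hcov₁.metric _ _ p (hd₁ hB) (hd₁ hC) (horizontalLift F A p)
    have h2 := hcov₂.metric _ _ (F p) (hd₂ hB) (hd₂ hC) (A (F p))
    have h3 : (fun q ↦ (inner ℝ (horizontalLift (E₁ := E₁) F B q) (horizontalLift F C q) : ℝ))
        = (fun x ↦ (inner ℝ (B x) (C x) : ℝ)) ∘ F := by
      ext q
      rw [Function.comp_apply, ← hdF hB q, ← inner_adjointMap (E₁ := E₁) F q]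
      rfl
    have h4 := DFunLike.congr_fun (mfderiv_comp p (mdifferentiableAt_inner (hd₂ hB) (hd₂ hC))
      (hF.smooth.mdifferentiableAt (x := p) (by simp))) (horizontalLift F A p)
    rw [← h3] at h4
    have h5 := h4.symm.trans h1
    have h6 := hdF hA p
    rw [← h6] at h2
    have h7 : @Eq ℝ _ _ := h2.symm.trans h5
    simp only [T, ← h6]
    rw [real_inner_comm (cov₂ C (F p) _), real_inner_comm (cov₁ (horizontalLift F C) p _)] at h7
    linarith
  -- a trilinear form symmetric in `A, B` and antisymmetric in `B, C` vanishes
  have key : T A B C = 0 := by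
    have e1 := hanti hA hB hC
    have e2 := hsymm (C := B) hA hC
    have e3 := hanti hC hA hB
    have e4 := hsymm (C := A) hC hB
    have e5 := hanti hB hC hA
    have e6 := hsymm (C := C) hB hA
    linarith
  exact sub_eq_zero.1 key

end Maps

/-! ### The identity characterizing totally geodesic normal foliations -/

section Maps

variable {E₁ : Type*} [NormedAddCommGroup E₁] [NormedSpace ℝ E₁] [FiniteDimensional ℝ E₁]
  {M₁ : Type*} [TopologicalSpace M₁] [ChartedSpace E₁ M₁] [IsManifold 𝓘(ℝ, E₁) ∞ M₁]
  [RiemannianBundle (fun x : M₁ ↦ TangentSpace 𝓘(ℝ, E₁) x)]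
  [IsContMDiffRiemannianBundle 𝓘(ℝ, E₁) ∞ E₁ (fun x : M₁ ↦ TangentSpace 𝓘(ℝ, E₁) x)]
  {E₂ : Type*} [NormedAddCommGroup E₂] [NormedSpace ℝ E₂] [FiniteDimensional ℝ E₂]
  {M₂ : Type*} [TopologicalSpace M₂] [ChartedSpace E₂ M₂] [IsManifold 𝓘(ℝ, E₂) ∞ M₂]
  [RiemannianBundle (fun x : M₂ ↦ TangentSpace 𝓘(ℝ, E₂) x)]
  [IsContMDiffRiemannianBundle 𝓘(ℝ, E₂) ∞ E₂ (fun x : M₂ ↦ TangentSpace 𝓘(ℝ, E₂) x)]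
  {F : M₁ → M₂} {U : Set M₂} {D : Π x : M₂, Submodule ℝ (TangentSpace 𝓘(ℝ, E₂) x)}

theorem rangePart_add_normalPart (F : M₁ → M₂) (p : M₁) (v : TangentSpace 𝓘(ℝ, E₂) (F p)) :
    rangePart (E₁ := E₁) F p v + normalPart (E₁ := E₁) F p v = v :=
  Submodule.starProjection_add_starProjection_orthogonal v

theorem inner_normalPart_of_mem {p : M₁} {v : TangentSpace 𝓘(ℝ, E₂) (F p)}
    (w : TangentSpace 𝓘(ℝ, E₂) (F p)) (hv : v ∈ rangeSpace (E₁ := E₁) F p) :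
    (inner ℝ (normalPart (E₁ := E₁) F p w) v : ℝ) = 0 :=
  Submodule.inner_left_of_mem_orthogonal hv (Submodule.starProjection_apply_mem _ _)

theorem inner_normalPart_of_mem_right {p : M₁} {v : TangentSpace 𝓘(ℝ, E₂) (F p)}
    (w : TangentSpace 𝓘(ℝ, E₂) (F p)) (hv : v ∈ rangeSpace (E₁ := E₁) F p) :
    (inner ℝ v (normalPart (E₁ := E₁) F p w) : ℝ) = 0 := by
  rw [real_inner_comm, inner_normalPart_of_mem w hv]

/-- The two sides of the identity characterizing totally geodesic foliations differ by
`g₂(Y, ∇_{V₁} V₂)`. -/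
theorem inner_shapeOperator_sub
    {cov₁ : CovariantDerivative 𝓘(ℝ, E₁) E₁ (fun x : M₁ ↦ TangentSpace 𝓘(ℝ, E₁) x)}
    (hcov₁ : IsLeviCivita cov₁)
    {cov₂ : CovariantDerivative 𝓘(ℝ, E₂) E₂ (fun x : M₂ ↦ TangentSpace 𝓘(ℝ, E₂) x)}
    (hcov₂ : IsLeviCivita cov₂)
    {ψ : Π x : M₂, TangentSpace 𝓘(ℝ, E₂) x →L[ℝ] TangentSpace 𝓘(ℝ, E₂) x}
    {ξ : Π x : M₂, TangentSpace 𝓘(ℝ, E₂) x} {η : Π x : M₂, TangentSpace 𝓘(ℝ, E₂) x →L[ℝ] ℝ}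
    (hK : IsKenmotsu cov₂ ψ ξ η) (hF : IsRiemannianMap (E₁ := E₁) (E₂ := E₂) F)
    (hξ : ∀ p : M₁, ξ (F p) ∈ rangeSpace (E₁ := E₁) F p)
    (hU : IsOpen U) (hFU : Set.range F ⊆ U) (hD : IsSmoothDistributionOn U D)
    (hDF : ∀ p : M₁, D (F p) = rangeSpace (E₁ := E₁) F p)
    {X : Π p : M₁, TangentSpace 𝓘(ℝ, E₁) p} {V₁ V₂ Y : Π x : M₂, TangentSpace 𝓘(ℝ, E₂) x} {p : M₁}
    (hX : X p ∈ horizontalSpace (E₁ := E₁) (E₂ := E₂) F p)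
    (hV₁ : IsSectionOn U (orthDistribution D) V₁) (hV₂ : IsSectionOn U (orthDistribution D) V₂)
    (hY : IsSectionOn U D Y) (hYX : Y (F p) = dMap (E₁ := E₁) (E₂ := E₂) F p (X p)) :
    let Z : Π q : M₁, TangentSpace 𝓘(ℝ, E₁) q := fun q ↦
      adjointMap (E₁ := E₁) F q (phi (E₁ := E₁) F ψ V₁ q)
    (inner ℝ (shapeOperator cov₂ F (omega (E₁ := E₁) F ψ V₁) X p
          - dMap (E₁ := E₁) (E₂ := E₂) F p (cov₁ Z p (X p))) (phi (E₁ := E₁) F ψ V₂ p) : ℝ)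
      = inner ℝ (VectorField.mlieBracket 𝓘(ℝ, E₂) V₁ Y (F p)) (V₂ (F p))
        + inner ℝ (secondFundamentalForm cov₁ cov₂ F X Z p
            + normalConnection cov₂ F X (omega (E₁ := E₁) F ψ V₁) p) (omega (E₁ := E₁) F ψ V₂ p)
        + inner ℝ (Y (F p)) (cov₂ V₂ (F p) (V₁ (F p))) := by
  intro Z
  have hx : F p ∈ U := hFU ⟨p, rfl⟩
  have hUx : U ∈ 𝓝 (F p) := hU.mem_nhds hx
  have hFd : MDifferentiableAt 𝓘(ℝ, E₁) 𝓘(ℝ, E₂) F p := hF.smooth.mdifferentiableAt (by simp)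
  -- the tangential and the normal part of `ψ V` extend to smooth fields on `U`
  let P (V : Π x : M₂, TangentSpace 𝓘(ℝ, E₂) x) : Π x : M₂, TangentSpace 𝓘(ℝ, E₂) x :=
    fun x ↦ (D x).starProjection (ψ x (V x))
  let N (V : Π x : M₂, TangentSpace 𝓘(ℝ, E₂) x) : Π x : M₂, TangentSpace 𝓘(ℝ, E₂) x :=
    fun x ↦ ψ x (V x) - P V x
  have hP : ∀ {V}, IsSectionOn U (orthDistribution D) V → IsSectionOn U D (P V) := fun hV ↦
    ⟨smoothFieldOn_orthogonalProjection hU hD (hK.smoothFieldOn_psi hV.smooth),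
      fun x _ ↦ Submodule.starProjection_apply_mem _ _⟩
  have hphi : ∀ V q, phi (E₁ := E₁) F ψ V q = P V (F q) := fun V q ↦ by
    simp only [phi, rangePart, P, hDF q]
  have homega : omega (E₁ := E₁) F ψ V₁ = fun q ↦ N V₁ (F q) := by
    ext q
    simp only [N]
    rw [← hphi, eq_sub_iff_add_eq, add_comm]
    exact rangePart_add_normalPart F q _
  have hPd : MDiffAt (T% (P V₁)) (F p) := (hP hV₁).smooth.mdifferentiableAt hUx
  have hNd : MDiffAt (T% (N V₁)) (F p) :=
    SmoothFieldOn.mdifferentiableAt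
      (ContMDiffOn.sub_section (hK.smoothFieldOn_psi hV₁.smooth) (hP hV₁).smooth) hUx
  have hη : ∀ {V}, IsSectionOn U (orthDistribution D) V → η (F p) (V (F p)) = 0 := fun hV ↦ by
    rw [hK.eta_eq]
    exact Submodule.inner_left_of_mem_orthogonal (hDF p ▸ hξ p) (hV.mem _ hx)
  have hZ : Z = horizontalLift F (P V₁) := by
    ext q
    simp only [Z, hphi]
    rfl
  -- only the value of `X` at `p` matters, so `X` may be replaced by the lift of `Y`
  have hXY : X p = horizontalLift F Y p := by
    simp only [horizontalLift, hYX]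
    exact (hF.adjointMap_dMap hX).symm
  -- `∇F_*(X, Z)` is orthogonal to the range of `F_*`
  have hsff : (inner ℝ (cov₂ (P V₁) (F p) (Y (F p))) (P V₂ (F p)) : ℝ)
      = inner ℝ (dMap (E₁ := E₁) (E₂ := E₂) F p (cov₁ Z p (X p))) (P V₂ (F p)) := by
    rw [hF.inner_cov_horizontalLift hcov₁ hcov₂ hU hFU hDF hY (hP hV₁) (hP hV₂), hZ, hXY]
    exact inner_adjointMap F p _ _
  have hsum : cov₂ (fun x ↦ ψ x (V₁ x)) (F p) (Y (F p))
      = cov₂ (P V₁) (F p) (Y (F p)) + cov₂ (N V₁) (F p) (Y (F p)) := by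
    have h : (fun x ↦ ψ x (V₁ x)) = P V₁ + N V₁ := by
      ext x
      simp [N]
    rw [h, cov₂.isCovariantDerivativeOnUniv.add hPd hNd]
    rfl
  have hψ := hK.inner_cov_psi (hV₁.smooth.mdifferentiableAt hUx) (hη hV₁) (hη hV₂) (Y (F p))
  rw [hsum] at hψ
  have hψV₂ : ψ (F p) (V₂ (F p)) = P V₂ (F p) + omega (E₁ := E₁) F ψ V₂ p := by
    rw [← hphi]
    exact (rangePart_add_normalPart F p _).symm
  have hpb : pullbackCov cov₂ F (omega (E₁ := E₁) F ψ V₁) p (X p)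
      = cov₂ (N V₁) (F p) (Y (F p)) := by
    rw [homega, pullbackCov_comp cov₂ hFd hNd, hYX]
  have hpbP : pullbackCov cov₂ F (fun q ↦ dMap (E₁ := E₁) (E₂ := E₂) F q (Z q)) p (X p)
      = cov₂ (P V₁) (F p) (Y (F p)) := by
    have h : (fun q ↦ dMap (E₁ := E₁) (E₂ := E₂) F q (Z q)) = fun q ↦ P V₁ (F q) := by
      ext q
      rw [hZ]
      exact hF.dMap_horizontalLift hFU hDF (hP hV₁) q
    rw [h, pullbackCov_comp cov₂ hFd hPd, hYX]
  have hPm : P V₂ (F p) ∈ rangeSpace (E₁ := E₁) F p := hDF p ▸ (hP hV₂).mem _ hx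
  have hω : ∀ w ∈ rangeSpace (E₁ := E₁) F p, (inner ℝ w (omega (E₁ := E₁) F ψ V₂ p) : ℝ) = 0 :=
    fun w hw ↦ inner_normalPart_of_mem_right _ hw
  have hF₁ : (inner ℝ (dMap (E₁ := E₁) (E₂ := E₂) F p (cov₁ Z p (X p)))
      (omega (E₁ := E₁) F ψ V₂ p) : ℝ) = 0 := hω _ ⟨_, rfl⟩
  -- the components of `∇_Y (N V₁)`
  set n := cov₂ (N V₁) (F p) (Y (F p)) with hn
  have hn₁ : (inner ℝ (rangePart (E₁ := E₁) F p n) (P V₂ (F p)) : ℝ) = inner ℝ n (P V₂ (F p)) := by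
    conv_rhs => rw [← rangePart_add_normalPart (E₁ := E₁) F p n]
    rw [inner_add_left, inner_normalPart_of_mem _ hPm, add_zero]
  have hn₂ : (inner ℝ (normalPart (E₁ := E₁) F p n) (omega (E₁ := E₁) F ψ V₂ p) : ℝ)
      = inner ℝ n (omega (E₁ := E₁) F ψ V₂ p) := by
    conv_rhs => rw [← rangePart_add_normalPart (E₁ := E₁) F p n]
    rw [inner_add_left, hω (rangePart (E₁ := E₁) F p n) (Submodule.starProjection_apply_mem _ _),
      zero_add]
  have hbr := hcov₂.torsionFree V₁ Y (F p) (hV₁.smooth.mdifferentiableAt hUx)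
    (hY.smooth.mdifferentiableAt hUx)
  have horth := hcov₂.inner_cov_of_orthogonal (hY.smooth.mdifferentiableAt hUx)
    (hV₂.smooth.mdifferentiableAt hUx) (Filter.eventually_of_mem hUx fun y hy ↦
      Submodule.inner_right_of_mem_orthogonal (hY.mem y hy) (hV₂.mem y hy)) (V₁ (F p))
  rw [hψV₂] at hψ
  simp only [shapeOperator, normalConnection, secondFundamentalForm, hpb, hpbP]
  rw [← hbr, hphi]
  simp only [inner_add_left, inner_add_right, inner_sub_left, inner_neg_left] at hψ ⊢
  rw [hn₁, hn₂, hF₁]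
  linarith

end Maps

end BiSlant

theorem theorem3p2
    {E₁ : Type*} [NormedAddCommGroup E₁] [NormedSpace ℝ E₁] [FiniteDimensional ℝ E₁]
    {M₁ : Type*} [TopologicalSpace M₁] [T2Space M₁] [ChartedSpace E₁ M₁]
    [IsManifold 𝓘(ℝ, E₁) ∞ M₁]
    [RiemannianBundle (fun x : M₁ ↦ TangentSpace 𝓘(ℝ, E₁) x)]
    [IsContMDiffRiemannianBundle 𝓘(ℝ, E₁) ∞ E₁ (fun x : M₁ ↦ TangentSpace 𝓘(ℝ, E₁) x)]
    {E₂ : Type*} [NormedAddCommGroup E₂] [NormedSpace ℝ E₂] [FiniteDimensional ℝ E₂]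
    {M₂ : Type*} [TopologicalSpace M₂] [T2Space M₂] [ChartedSpace E₂ M₂]
    [IsManifold 𝓘(ℝ, E₂) ∞ M₂]
    [RiemannianBundle (fun x : M₂ ↦ TangentSpace 𝓘(ℝ, E₂) x)]
    [IsContMDiffRiemannianBundle 𝓘(ℝ, E₂) ∞ E₂ (fun x : M₂ ↦ TangentSpace 𝓘(ℝ, E₂) x)]
    -- the Levi-Civita connections of the two manifolds
    (cov₁ : CovariantDerivative 𝓘(ℝ, E₁) E₁ (fun x : M₁ ↦ TangentSpace 𝓘(ℝ, E₁) x))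
    (hcov₁ : BiSlant.IsLeviCivita cov₁)
    (cov₂ : CovariantDerivative 𝓘(ℝ, E₂) E₂ (fun x : M₂ ↦ TangentSpace 𝓘(ℝ, E₂) x))
    (hcov₂ : BiSlant.IsLeviCivita cov₂)
    -- the Kenmotsu structure of the target
    (ψ : Π x : M₂, TangentSpace 𝓘(ℝ, E₂) x →L[ℝ] TangentSpace 𝓘(ℝ, E₂) x)
    (ξ : Π x : M₂, TangentSpace 𝓘(ℝ, E₂) x)
    (η : Π x : M₂, TangentSpace 𝓘(ℝ, E₂) x →L[ℝ] ℝ)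
    (hK : BiSlant.IsKenmotsu cov₂ ψ ξ η)
    -- the map, with `ξ` tangent to its range
    (F : M₁ → M₂) (hF : BiSlant.IsBiSlantRiemannianMap (E₁ := E₁) F ψ ξ)
    -- `range F_*` as a distribution `D` on an open set `U` containing the image of `F`
    (U : Set M₂) (hU : IsOpen U) (hFU : Set.range F ⊆ U)
    (D : Π x : M₂, Submodule ℝ (TangentSpace 𝓘(ℝ, E₂) x))
    (hD : BiSlant.IsSmoothDistributionOn U D)
    (hDF : ∀ p : M₁, D (F p) = BiSlant.rangeSpace (E₁ := E₁) F p) :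
    BiSlant.IsTotallyGeodesicFoliationAlong cov₂ U (BiSlant.orthDistribution D) (Set.range F) ↔
      ∀ (X : Π p : M₁, TangentSpace 𝓘(ℝ, E₁) p) (V₁ V₂ : Π x : M₂, TangentSpace 𝓘(ℝ, E₂) x),
        BiSlant.IsHorizontalField (E₂ := E₂) F X →
        BiSlant.IsSectionOn U (BiSlant.orthDistribution D) V₁ →
        BiSlant.IsSectionOn U (BiSlant.orthDistribution D) V₂ →
        ∀ p : M₁,
        -- `Y` is a section of `range F_*` representing `F_* X` at the point
        ∀ Y : Π x : M₂, TangentSpace 𝓘(ℝ, E₂) x, BiSlant.IsSectionOn U D Y →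
          Y (F p) = BiSlant.dMap (E₁ := E₁) (E₂ := E₂) F p (X p) →
          -- `Z = ^*F_* φ V₁`
          let Z : Π q : M₁, TangentSpace 𝓘(ℝ, E₁) q := fun q ↦
            BiSlant.adjointMap (E₁ := E₁) F q (BiSlant.phi (E₁ := E₁) F ψ V₁ q)
          inner ℝ
              (BiSlant.shapeOperator cov₂ F (BiSlant.omega (E₁ := E₁) F ψ V₁) X p
                - BiSlant.dMap (E₁ := E₁) (E₂ := E₂) F p (cov₁ Z p (X p)))
              (BiSlant.phi (E₁ := E₁) F ψ V₂ p)
            = inner ℝ (VectorField.mlieBracket 𝓘(ℝ, E₂) V₁ Y (F p)) (V₂ (F p))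
              + inner ℝ
                (BiSlant.secondFundamentalForm cov₁ cov₂ F X Z p
                  + BiSlant.normalConnection cov₂ F X (BiSlant.omega (E₁ := E₁) F ψ V₁) p)
                (BiSlant.omega (E₁ := E₁) F ψ V₂ p) := by
  have hx : ∀ p : M₁, F p ∈ U := fun p ↦ hFU ⟨p, rfl⟩
  constructor
  · intro hfol X V₁ V₂ hX hV₁ hV₂ p Y hY hYX Z
    have h := BiSlant.inner_shapeOperator_sub hcov₁ hcov₂ hK hF.toIsRiemannianMap hF.xi_mem hU hFU
      hD hDF (hX.mem p) hV₁ hV₂ hY hYX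
    have h0 : (inner ℝ (Y (F p)) (cov₂ V₂ (F p) (V₁ (F p))) : ℝ) = 0 :=
      Submodule.inner_right_of_mem_orthogonal (hY.mem _ (hx p))
        (hfol V₁ V₂ hV₁ hV₂ (F p) ⟨p, rfl⟩).2
    exact h.trans (by rw [h0, add_zero])
  · intro hid
    -- test `∇_V W` against a section `Y` of `D`, with the horizontal lift of `Y` as `X`
    have hcov : ∀ V W : Π x : M₂, TangentSpace 𝓘(ℝ, E₂) x,
        BiSlant.IsSectionOn U (BiSlant.orthDistribution D) V →
        BiSlant.IsSectionOn U (BiSlant.orthDistribution D) W →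
        ∀ p : M₁, cov₂ W (F p) (V (F p)) ∈ BiSlant.orthDistribution D (F p) := by
      intro V W hV hW p v hv
      obtain ⟨Y, hY, rfl⟩ := BiSlant.exists_isSectionOn hD (hx p) hv
      have hX : BiSlant.IsHorizontalField (E₂ := E₂) F
          (BiSlant.horizontalLift (E₁ := E₁) F Y) :=
        ⟨BiSlant.smoothFieldOn_horizontalLift hF.smooth hFU hY.smooth,
          fun q ↦ BiSlant.adjointMap_mem_horizontalSpace F q _⟩
      have hYX := (hF.dMap_horizontalLift hFU hDF hY p).symm
      have h := BiSlant.inner_shapeOperator_sub hcov₁ hcov₂ hK hF.toIsRiemannianMap hF.xi_mem hU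
        hFU hD hDF (hX.mem p) hV hW hY hYX
      have h' := hid _ V W hX hV hW p Y hY hYX
      exact left_eq_add.1 (h'.symm.trans h)
    rintro V W hV hW _ ⟨p, rfl⟩
    refine ⟨?_, hcov V W hV hW p⟩
    have hUx := hU.mem_nhds (hx p)
    rw [← hcov₂.torsionFree V W (F p) (hV.smooth.mdifferentiableAt hUx)
      (hW.smooth.mdifferentiableAt hUx)]
    exact Submodule.sub_mem _ (hcov V W hV hW p) (hcov W V hW hV p)
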